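/- **Theorem 2.5.** Let $D\subset\mathbb R^d$ be a bounded convex domain with $C^2$ boundary, let $\Pi(x)$ be the metric projection of $x\in\mathbb R^d$ on $\bar D$, and let $\mathbf n(x)$ be the inward unit normal at $x\in\partial D$. For $k:\mathbb R_+\to\mathbb R^d$ of locally bounded variation let $|k|_t$ be its total variation on $[0,t]$ and $\|k\|_t=|k_0|+|k|_t$; integrals $\int_0^t$ with respect to $d|k|$ are over $(0,t]$, integrals over $[0,t]$ with respect to $d\|k\|$ include the atom $|k_0|$ at $0$, and $\Delta k_t=k_t-k_{t-}$ with the convention $k_{0-}=0$. For a càdlàg function $y:\mathbb R_+\to\mathbb R^d$, a pair $(x,k)$ of càdlàg functions $\mathbb R_+\to\mathbb R^d$ is a solution of the Skorokhod problem associated with $y$ if, for all $t\ge 0$, $x_t=y_t+k_t$ and $x_t\in\bar D$, $k$ is of locally bounded variation, $k_0=\Pi(y_0)-y_0$, $k_t=k_0+\int_0^t\mathbf n(x_s)\,d|k|_s$ and $|k|_t=\int_0^t\mathbf 1_{\{x_s\in\partial D\}}\,d|k|_s$. For $T>0$, $g\in C(\mathbb R_+\times\mathbb R^d)$ (real-valued)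 and such $(x,k)$ put $$I_T(g,x,k)=\int_{[0,T]}g(s,x_s)\,d\|k\|_s+\sum_{0\le s\le T}\int_0^{|\Delta k_s|}\bar g(s,x_s-r\mathbf n(x_s))\,dr,\qquad \bar g(s,x)=g(s,x)-g(s,\Pi(x)).$$ Let $y^n,y$ be càdlàg functions $\mathbb R_+\to\mathbb R^d$ with $y^n\to y$ in the Skorokhod $J_1$-topology, and let $(x^n,k^n)$ and $(x,k)$ be the solutions of the Skorokhod problem associated with $y^n$ and $y$, respectively. Let $T>0$ be such that $\Delta y_T=0$, and let $f_n,f,g_n,g\in C(\mathbb R_+\times\mathbb R^d)$ be real-valued functions such that, as $n\to\infty$, $$\sup_{0\le s\le T,\;x\in\bar D}|f_n(s,x)-f(s,x)|\to0\qquad\text{and}\qquad \sup_{0\le s\le T,\;x\in K}|g_n(s,x)-g(s,x)|\to0\ \text{ for every compact } K\subset\mathbb R^d .$$ Then $$\int_0^Tf_n(s,x^n_s)\,ds\to\int_0^Tf(s,x_s)\,ds\qquad\text{and}\qquad I_T(g_n,x^n,k^n)\to I_T(g,x,k).$$ -/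

import Mathlib

open Set Filter Topology MeasureTheory
open scoped NNReal ENNReal

noncomputable section

/-! ### The domain, its metric projection and its inward unit normal -/

/-- `D` is a bounded convex domain with boundary of class `C²`: a non-empty, open, bounded, convex
set (hence connected) which, near each boundary point, is the positivity set of a `C²` function
with non-vanishing derivative at that point. -/
structure IsBoundedConvexC2Domain {d : ℕ} (D : Set (EuclideanSpace ℝ (Fin d))) : Prop where
  isOpen : IsOpen D
  nonempty : D.Nonempty
  bounded : Bornology.IsBounded D
  convex : Convex ℝ D
  boundary : ∀ p ∈ frontier D, ∃ ρ : EuclideanSpace ℝ (Fin d) → ℝ,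
    ContDiffAt ℝ 2 ρ p ∧ ρ p = 0 ∧ fderiv ℝ ρ p ≠ 0 ∧ ∀ᶠ z in 𝓝 p, (z ∈ D ↔ 0 < ρ z)

/-- `p` is a point of the closure of `D` at minimal distance from `x`. -/
def IsMetricProj {d : ℕ} (D : Set (EuclideanSpace ℝ (Fin d)))
    (x p : EuclideanSpace ℝ (Fin d)) : Prop :=
  p ∈ closure D ∧ dist x p = Metric.infDist x (closure D)

/-- The metric projection `Π(x)` of `x` on the closure of `D`
(see `existsUnique_isMetricProj` for existence and uniqueness). -/
def metricProj {d : ℕ} (D : Set (EuclideanSpace ℝ (Fin d)))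
    (x : EuclideanSpace ℝ (Fin d)) : EuclideanSpace ℝ (Fin d) :=
  Classical.epsilon (IsMetricProj D x)

/-- `v` is an inward unit normal vector to the convex set `D` at its boundary point `x`.
For a convex `C²` domain such a `v` exists and is unique (`existsUnique_isInwardUnitNormal`), and
is the normalized gradient of any local defining function (`IsInwardUnitNormal.eq_gradient`). -/
def IsInwardUnitNormal {d : ℕ} (D : Set (EuclideanSpace ℝ (Fin d)))
    (x v : EuclideanSpace ℝ (Fin d)) : Prop :=
  ‖v‖ = 1 ∧ ∀ z ∈ closure D, 0 ≤ inner ℝ (z - x) v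

open scoped Classical in
/-- The inward unit normal vector `n(x)` at `x ∈ ∂D`; it is set to `0` off the boundary, where it
is never used. -/
def inwardNormal {d : ℕ} (D : Set (EuclideanSpace ℝ (Fin d)))
    (x : EuclideanSpace ℝ (Fin d)) : EuclideanSpace ℝ (Fin d) :=
  if x ∈ frontier D then Classical.epsilon (IsInwardUnitNormal D x) else 0

theorem existsUnique_isMetricProj {d : ℕ} {D : Set (EuclideanSpace ℝ (Fin d))}
    (hD : IsBoundedConvexC2Domain D) (x : EuclideanSpace ℝ (Fin d)) :
    ∃! p, IsMetricProj D x p := by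
  obtain ⟨p, hp, hdist⟩ := isClosed_closure.exists_infDist_eq_dist hD.nonempty.closure x
  refine ⟨p, ⟨hp, hdist.symm⟩, ?_⟩
  rintro q ⟨hq, hqd⟩
  have hmid : (1 / 2 : ℝ) • p + (1 / 2 : ℝ) • q ∈ closure D :=
    hD.convex.closure hp hq (by norm_num) (by norm_num) (by norm_num)
  have h1 : Metric.infDist x (closure D) ≤ ‖x - ((1 / 2 : ℝ) • p + (1 / 2 : ℝ) • q)‖ := by
    rw [← dist_eq_norm]
    exact Metric.infDist_le_dist_of_mem hmid
  have h0 : 0 ≤ Metric.infDist x (closure D) := Metric.infDist_nonneg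
  have e1 : ‖x - p‖ = Metric.infDist x (closure D) := by rw [← dist_eq_norm, hdist]
  have e2 : ‖x - q‖ = Metric.infDist x (closure D) := by rw [← dist_eq_norm, hqd]
  have hpar := parallelogram_law_with_norm ℝ (x - p) (x - q)
  have e3 : (x - p) + (x - q) = (2 : ℝ) • (x - ((1 / 2 : ℝ) • p + (1 / 2 : ℝ) • q)) := by
    module
  have e4 : (x - p) - (x - q) = q - p := by abel
  rw [e3, e4, norm_smul, e1, e2, Real.norm_ofNat] at hpar
  have : ‖q - p‖ * ‖q - p‖ ≤ 0 := by nlinarith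
  have : ‖q - p‖ = 0 := by nlinarith [norm_nonneg (q - p)]
  exact sub_eq_zero.mp (norm_eq_zero.mp this)

theorem IsInwardUnitNormal.eq_gradient {d : ℕ} {D : Set (EuclideanSpace ℝ (Fin d))}
    {x v : EuclideanSpace ℝ (Fin d)} (hv : IsInwardUnitNormal D x v)
    {ρ : EuclideanSpace ℝ (Fin d) → ℝ} (hρ : ContDiffAt ℝ 2 ρ x) (h0 : ρ x = 0)
    (hne : fderiv ℝ ρ x ≠ 0) (hD : ∀ᶠ z in 𝓝 x, (z ∈ D ↔ 0 < ρ z)) :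
    v = ‖gradient ρ x‖⁻¹ • gradient ρ x := by
  have hdiff : DifferentiableAt ℝ ρ x := hρ.differentiableAt (by norm_num)
  set G := gradient ρ x with hG
  have key : ∀ w : EuclideanSpace ℝ (Fin d), 0 < inner ℝ G w → 0 ≤ inner ℝ w v := by
    intro w hw
    have hline : HasDerivAt (fun t : ℝ => x + t • w) w 0 := by
      simpa using ((hasDerivAt_id (0 : ℝ)).smul_const w).const_add x
    have hd : HasDerivAt (fun t : ℝ => ρ (x + t • w)) (inner ℝ G w) 0 := by
      have h := hdiff.hasGradientAt.hasFDerivAt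
      have h' : HasFDerivAt ρ (InnerProductSpace.toDual ℝ _ G) (x + (0 : ℝ) • w) := by
        rw [zero_smul, add_zero]
        exact h
      exact h'.comp_hasDerivAt (0 : ℝ) hline
    have hpos : ∀ᶠ t in 𝓝[>] (0 : ℝ), 0 < ρ (x + t • w) := by
      have hs := (hasDerivAt_iff_tendsto_slope.mp hd).mono_left
        (nhdsWithin_mono 0 (fun t (ht : 0 < t) => ht.ne'))
      filter_upwards [hs.eventually (lt_mem_nhds hw), self_mem_nhdsWithin] with t ht ht0
      have ht0 : 0 < t := ht0
      rw [slope_def_field] at ht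
      simp only [zero_smul, add_zero, h0, sub_zero] at ht
      exact (div_pos_iff_of_pos_right ht0).mp ht
    have hmem : ∀ᶠ t in 𝓝[>] (0 : ℝ), (x + t • w ∈ D ↔ 0 < ρ (x + t • w)) := by
      have : Tendsto (fun t : ℝ => x + t • w) (𝓝[>] 0) (𝓝 x) := by
        have := hline.continuousAt.tendsto
        simp only [zero_smul, add_zero] at this
        exact this.mono_left nhdsWithin_le_nhds
      exact this.eventually hD
    obtain ⟨t, ⟨h1, h2⟩, h3⟩ := ((hpos.and hmem).and self_mem_nhdsWithin).exists
    have h3 : 0 < t := h3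
    have := hv.2 _ (subset_closure (h2.mpr h1))
    rw [add_sub_cancel_left, inner_smul_left] at this
    exact nonneg_of_mul_nonneg_right (by simpa using this) h3
  have hG0 : G ≠ 0 := by
    intro h
    apply hne
    rw [hG, gradient] at h
    simpa using h
  have hGG : 0 < ‖G‖ := norm_pos_iff.mpr hG0
  have hnn : ‖v‖ ^ 2 = 1 := by rw [hv.1]; norm_num
  -- the Cauchy-Schwarz inequality is an equality
  have hle : ∀ ε : ℝ, 0 < ε → ‖G‖ ^ 2 ≤ inner ℝ G v ^ 2 + ε * inner ℝ G v := by
    intro ε hε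
    have h := key ((inner ℝ G v + ε) • G - (‖G‖ ^ 2) • v) (by
      rw [inner_sub_right, inner_smul_right, inner_smul_right, real_inner_self_eq_norm_sq]
      have : 0 < ε * ‖G‖ ^ 2 := by positivity
      linarith)
    rw [inner_sub_left, inner_smul_left, inner_smul_left, real_inner_self_eq_norm_sq, hnn] at h
    simp only [conj_trivial] at h
    nlinarith
  have hsq : ‖G‖ ^ 2 ≤ inner ℝ G v ^ 2 := by
    have hlim : Tendsto (fun ε : ℝ => inner ℝ G v ^ 2 + ε * inner ℝ G v) (𝓝[>] 0)
        (𝓝 (inner ℝ G v ^ 2)) := by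
      have : Continuous (fun ε : ℝ => inner ℝ G v ^ 2 + ε * inner ℝ G v) := by fun_prop
      have := this.tendsto 0
      simp only [zero_mul, add_zero] at this
      exact this.mono_left nhdsWithin_le_nhds
    refine ge_of_tendsto hlim ?_
    filter_upwards [self_mem_nhdsWithin] with ε hε using hle ε hε
  have hpos : 0 ≤ inner ℝ G v := key G (by rw [real_inner_self_eq_norm_sq]; positivity)
  have hge : ‖G‖ ≤ inner ℝ G v := le_trans (le_abs_self _) (abs_le_of_sq_le_sq hsq hpos)
  have hge' : inner ℝ G v = ‖G‖ :=
    le_antisymm (by simpa [hv.1] using real_inner_le_norm G v) hge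
  have hz : ‖v - ‖G‖⁻¹ • G‖ ^ 2 = 0 := by
    rw [norm_sub_sq_real, inner_smul_right, real_inner_comm, hge', norm_smul, hv.1, norm_inv,
      norm_norm]
    field_simp
    norm_num
  exact sub_eq_zero.mp (norm_eq_zero.mp (pow_eq_zero_iff (two_ne_zero)|>.mp hz))

theorem existsUnique_isInwardUnitNormal {d : ℕ} {D : Set (EuclideanSpace ℝ (Fin d))}
    (hD : IsBoundedConvexC2Domain D) {x : EuclideanSpace ℝ (Fin d)} (hx : x ∈ frontier D) :
    ∃! v, IsInwardUnitNormal D x v := by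
  obtain ⟨ρ, hρ, h0, hne, hev⟩ := hD.boundary x hx
  have hxD : x ∉ D := by
    rw [hD.isOpen.frontier_eq] at hx
    exact hx.2
  obtain ⟨φ, hφ⟩ := geometric_hahn_banach_open_point hD.convex hD.isOpen hxD
  set u := (InnerProductSpace.toDual ℝ (EuclideanSpace ℝ (Fin d))).symm φ with hu
  have hφu : ∀ z, φ z = inner ℝ u z := fun z => by
    rw [hu, InnerProductSpace.toDual_symm_apply]
  obtain ⟨a, ha⟩ := hD.nonempty
  have hu0 : u ≠ 0 := by
    intro h
    have := hφ a ha
    simp [hφu, h] at this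
  have hun : 0 < ‖u‖ := norm_pos_iff.mpr hu0
  have hex : IsInwardUnitNormal D x (-(‖u‖⁻¹ • u)) := by
    refine ⟨?_, ?_⟩
    · rw [norm_neg, norm_smul, norm_inv, norm_norm, inv_mul_cancel₀ hun.ne']
    · have hcl : closure D ⊆ {z | inner ℝ u z ≤ inner ℝ u x} := by
        refine closure_minimal (fun z hz => ?_) ?_
        · have := hφ z hz
          rw [hφu, hφu] at this
          exact this.le
        · exact isClosed_le (by fun_prop) (by fun_prop)
      intro z hz
      have h : inner ℝ u z ≤ inner ℝ u x := hcl hz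
      rw [inner_neg_right, inner_smul_right, real_inner_comm, inner_sub_right]
      have : 0 ≤ ‖u‖⁻¹ * (inner ℝ u x - inner ℝ u z) :=
        mul_nonneg (inv_nonneg.mpr hun.le) (sub_nonneg.mpr h)
      linarith
  refine ⟨_, hex, fun w hw => ?_⟩
  rw [hw.eq_gradient hρ h0 hne hev, hex.eq_gradient hρ h0 hne hev]

/-! ### Càdlàg paths, jumps and total variation -/

/-- `y : ℝ₊ → ℝᵈ` is right continuous and has left-hand limits. -/
def IsCadlag {d : ℕ} (y : ℝ≥0 → EuclideanSpace ℝ (Fin d)) : Prop :=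
  ∀ t : ℝ≥0, ContinuousWithinAt y (Ici t) t ∧ ∃ l, Tendsto y (𝓝[<] t) (𝓝 l)

/-- The jump `Δk_t = k_t - k_{t-}`, with the convention `k_{0-} = 0`. -/
def jump {d : ℕ} (k : ℝ≥0 → EuclideanSpace ℝ (Fin d)) (t : ℝ≥0) : EuclideanSpace ℝ (Fin d) :=
  if t = 0 then k 0 else k t - Function.leftLim k t

/-- The total variation `|k|_t` of `k` on `[0, t]` (for `k` of locally bounded variation). -/
def totalVar {d : ℕ} (k : ℝ≥0 → EuclideanSpace ℝ (Fin d)) (t : ℝ≥0) : ℝ :=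
  (eVariationOn k (Icc 0 t)).toReal

theorem monotone_totalVar {d : ℕ} {k : ℝ≥0 → EuclideanSpace ℝ (Fin d)}
    (hk : LocallyBoundedVariationOn k univ) : Monotone (totalVar k) := by
  intro s t hst
  refine ENNReal.toReal_mono ?_ (eVariationOn.mono k (Icc_subset_Icc_right hst))
  have h := hk 0 t (mem_univ _) (mem_univ _)
  rw [univ_inter] at h
  exact h

open scoped Classical in
/-- The measure `d|k|` on `ℝ₊`: the Stieltjes measure of the function `t ↦ |k|_t`. It does not
charge `{0}`, and for right continuous `k` it gives mass `|k|_t - |k|_s` to `(s, t]`. (By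
convention it is `0` if `k` is not of locally bounded variation.) -/
def variationMeasure {d : ℕ} (k : ℝ≥0 → EuclideanSpace ℝ (Fin d)) : Measure ℝ≥0 :=
  if hk : LocallyBoundedVariationOn k univ then (monotone_totalVar hk).stieltjesFunction.measure
  else 0

/-- The measure `d‖k‖` on `ℝ₊`, where `‖k‖_t = |k_0| + |k|_t`, with the convention
`‖k‖_{0-} = 0`: it is `d|k|` plus a mass `|k_0|` at time `0`. -/
def normVariationMeasure {d : ℕ} (k : ℝ≥0 → EuclideanSpace ℝ (Fin d)) : Measure ℝ≥0 :=
  variationMeasure k + ENNReal.ofReal ‖k 0‖ • Measure.dirac 0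

/-! ### The Skorokhod topology and the Skorokhod problem -/

/-- Convergence `yₙ → y` of càdlàg functions on `ℝ₊` in the Skorokhod `J₁` topology: there are
increasing bijective time changes `λₙ` of `ℝ₊` such that `λₙ(t) - t → 0` uniformly in `t`, and
`yₙ(λₙ(t)) - y(t) → 0` uniformly in `t ∈ [0, N]`, for every `N`. -/
def TendstoJ1 {d : ℕ} (yn : ℕ → ℝ≥0 → EuclideanSpace ℝ (Fin d))
    (y : ℝ≥0 → EuclideanSpace ℝ (Fin d)) : Prop :=
  ∃ lam : ℕ → (ℝ≥0 ≃o ℝ≥0),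
    TendstoUniformly (fun n t => lam n t) (fun t => t) atTop ∧
    ∀ N : ℝ≥0, TendstoUniformlyOn (fun n t => yn n (lam n t)) y atTop (Icc 0 N)

/-- `(x, k)` is a solution of the (generalized) Skorokhod problem in `D` associated with `y`. -/
structure IsSkorokhodSolution {d : ℕ} (D : Set (EuclideanSpace ℝ (Fin d)))
    (y x k : ℝ≥0 → EuclideanSpace ℝ (Fin d)) : Prop where
  cadlag_x : IsCadlag x
  cadlag_k : IsCadlag k
  eq_add : ∀ t, x t = y t + k t
  mem_closure : ∀ t, x t ∈ closure D
  boundedVariation : LocallyBoundedVariationOn k univ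
  k_zero : k 0 = metricProj D (y 0) - y 0
  k_eq : ∀ t, k t = k 0 + ∫ s in Ioc 0 t, inwardNormal D (x s) ∂(variationMeasure k)
  variation_eq : ∀ t, totalVar k t =
    ∫ s in Ioc 0 t, {s | x s ∈ frontier D}.indicator (fun _ => (1 : ℝ)) s ∂(variationMeasure k)

/-- `ḡ(s, x) = g(s, x) - g(s, Π(x))`. -/
def gBar {d : ℕ} (D : Set (EuclideanSpace ℝ (Fin d))) (g : ℝ≥0 → EuclideanSpace ℝ (Fin d) → ℝ)
    (s : ℝ≥0) (x : EuclideanSpace ℝ (Fin d)) : ℝ :=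
  g s x - g s (metricProj D x)

/-- The functional
`I_T(g, x, k) = ∫_{[0,T]} g(s, x_s) d‖k‖_s + ∑_{0 ≤ s ≤ T} ∫_0^{|Δk_s|} ḡ(s, x_s - r n(x_s)) dr`. -/
def functionalI {d : ℕ} (D : Set (EuclideanSpace ℝ (Fin d))) (T : ℝ≥0)
    (g : ℝ≥0 → EuclideanSpace ℝ (Fin d) → ℝ) (x k : ℝ≥0 → EuclideanSpace ℝ (Fin d)) : ℝ :=
  (∫ s in Icc 0 T, g s (x s) ∂(normVariationMeasure k)) +
    ∑' s : Icc (0 : ℝ≥0) T, ∫ r in (0 : ℝ)..‖jump k s‖, gBar D g s (x s - r • inwardNormal D (x s))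

end

/-! ### Real induction and regulated functions -/

/-! Write `ν` for `d‖k‖`, the atom at `0` included. The conditions on `(x, k)` then read `k_t =
∫_{[0,t]} n(x) dν` with `ν` carried by the times at which `x ∈ ∂D` (`ReflectedPath`), and this form
survives time changes. Along the `J₁` time changes `λₙ`, the problem becomes stability under locally
uniform convergence `yⁿ → y`.

Stability is an energy estimate. Since `‖∫ dK‖² ≤ 2 ∫ ⟨K, dK⟩` and `k - k' = (x - x') - (y - y')`,
while `⟨z - x, n(x)⟩ ≥ 0` on the convex body, one gets `‖k_t - k'_t‖² ≤ 2 sup‖y - y'‖ (‖k‖_t +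
‖k'‖_t)` (`norm_sub_sq_le`). The variations are bounded uniformly in `n`: a ball inside `D` makes
`n` point inwards by a definite amount, so `ν` is bounded on open intervals where `y` oscillates
little (`mul_real_Ioo_le`), and atoms are bounded because `D` is. Hence `kⁿ`, `xⁿ`, the left limits
and the jumps converge locally uniformly.

Because `Π(x - r n(x)) = x` on `∂D`, the functional is one integral, `I_T = ∫_{[0,T]} H dν` with
`H_s = ∫_0^1 g(s, x_s - θ Δk_s) dθ` (`functionalI_eq`). The integrands converge uniformly after the
time change. For the measures, let `m` be a continuous extension of `n`. Then `H dν = ⟨H m(x), dk⟩`,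
and `∫ ⟨w, dkⁿ⟩ → ∫ ⟨w, dk⟩` for every regulated `w`, since `w` is almost constant on suitable open
intervals. The endpoint `λₙ⁻¹(T)` moves, which is harmless because `Δy_T = 0` forces `ν{T} = 0`.

The time integrals converge by bounded convergence: `xⁿ_t → x_t` at each continuity point of `x`,
thus off a countable set. -/

/-- Suited to paths with one-sided limits: a right limit extends a bound over a short interval after
`t`, a left limit brings it up to `t`, and the value at `t` is handled separately. -/
theorem NNReal.real_induction {P : ℝ≥0 → Prop} (h0 : P 0)
    (hr : ∀ t, P t → ∃ u, t < u ∧ ∀ s ∈ Ioo t u, P s)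
    (hl : ∀ t, 0 < t → (∀ s < t, P s) → P t) (t : ℝ≥0) : P t := by
  by_contra hP
  set S : Set ℝ≥0 := {s | ¬ P s} with hS
  have hne : S.Nonempty := ⟨t, hP⟩
  have hbelow : ∀ s < sInf S, P s := fun s hs => by
    by_contra h
    exact absurd (csInf_le (OrderBot.bddBelow S) (show s ∈ S from h)) (not_le.mpr hs)
  have hm : P (sInf S) := by
    rcases eq_zero_or_pos (sInf S) with h | h
    · rw [h]; exact h0
    · exact hl _ h hbelow
  obtain ⟨u, hu, hPu⟩ := hr _ hm
  obtain ⟨s, hs, hsu⟩ := exists_lt_of_csInf_lt hne hu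
  have h1 := csInf_le (OrderBot.bddBelow S) hs
  rcases h1.eq_or_lt with h | h
  · exact hs (h ▸ hm)
  · exact hs (hPu s ⟨h, hsu⟩)

/-- `w` has one-sided limits at every point. -/
def IsRegulated {E : Type*} [TopologicalSpace E] (w : ℝ≥0 → E) : Prop :=
  ∀ t : ℝ≥0, (∃ l, Tendsto w (𝓝[<] t) (𝓝 l)) ∧ ∃ r, Tendsto w (𝓝[>] t) (𝓝 r)

theorem IsCadlag.isRegulated {d : ℕ} {y : ℝ≥0 → EuclideanSpace ℝ (Fin d)} (hy : IsCadlag y) :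
    IsRegulated y := fun t =>
  ⟨(hy t).2, _, (hy t).1.tendsto.mono_left (nhdsWithin_mono t Ioi_subset_Ici_self)⟩

theorem exists_Ioo_of_eventually_nhdsLT {p : ℝ≥0 → Prop} {t : ℝ≥0} (ht : 0 < t)
    (h : ∀ᶠ s in 𝓝[<] t, p s) : ∃ a < t, ∀ s ∈ Ioo a t, p s :=
  (mem_nhdsLT_iff_exists_Ioo_subset' ht).mp h

theorem exists_Ioo_of_eventually_nhdsGT {p : ℝ≥0 → Prop} {t : ℝ≥0}
    (h : ∀ᶠ s in 𝓝[>] t, p s) : ∃ b, t < b ∧ ∀ s ∈ Ioo t b, p s :=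
  mem_nhdsGT_iff_exists_Ioo_subset.mp h

section PseudoMetric

variable {E : Type*} [PseudoMetricSpace E] {w : ℝ≥0 → E}

/-- For fixed `ε`, the one-sided limits give each point a neighbourhood containing no other point
where the oscillation condition fails. By the Lindelöf property such points are countable. -/
theorem IsRegulated.countable_not_continuousAt (hw : IsRegulated w) :
    {t | ¬ ContinuousAt w t}.Countable := by
  have key : ∀ ε : ℝ, 0 < ε →
      {t | ¬ ∀ᶠ u in 𝓝 t, dist (w u) (w t) < ε}.Countable := by
    intro ε hε
    set S := {t | ¬ ∀ᶠ u in 𝓝 t, dist (w u) (w t) < ε} with hS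
    have hloc : ∀ (l : E) (I : Set ℝ≥0), IsOpen I → (∀ s ∈ I, dist (w s) l < ε / 2) →
        ∀ t ∈ I, t ∉ S := by
      intro l I hI h t ht hts
      refine hts ?_
      filter_upwards [hI.mem_nhds ht] with u hu
      have := dist_triangle_right (w u) (w t) l
      linarith [h u hu, h t ht]
    have hU : ∀ t : ℝ≥0, {u | u ∉ S ∨ u = t} ∈ 𝓝 t := by
      intro t
      obtain ⟨⟨l, hl⟩, r, hr⟩ := hw t
      have h1 : ∀ᶠ u in 𝓝[<] t, u ∉ S := by
        rcases eq_zero_or_pos t with rfl | ht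
        · simp
        obtain ⟨a, ha, haI⟩ := exists_Ioo_of_eventually_nhdsLT ht
          (Metric.tendsto_nhds.mp hl (ε / 2) (by positivity))
        filter_upwards [Ioo_mem_nhdsLT ha] with u hu using hloc l _ isOpen_Ioo haI u hu
      have h2 : ∀ᶠ u in 𝓝[>] t, u ∉ S := by
        obtain ⟨a, ha, haI⟩ := exists_Ioo_of_eventually_nhdsGT
          (Metric.tendsto_nhds.mp hr (ε / 2) (by positivity))
        filter_upwards [Ioo_mem_nhdsGT ha] with u hu using hloc r _ isOpen_Ioo haI u hu
      have h3 : ∀ᶠ u in 𝓝[≠] t, u ∉ S := by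
        rw [← nhdsLT_sup_nhdsGT]
        exact eventually_sup.mpr ⟨h1, h2⟩
      rw [eventually_nhdsWithin_iff] at h3
      filter_upwards [h3] with u hu
      by_cases h : u = t
      · exact Or.inr h
      · exact Or.inl (hu h)
    obtain ⟨C, hC, hcov⟩ := TopologicalSpace.countable_cover_nhds hU
    refine hC.mono fun t ht => ?_
    have : t ∈ ⋃ x ∈ C, {u | u ∉ S ∨ u = x} := by rw [hcov]; trivial
    simp only [mem_iUnion, mem_ofPred_eq] at this
    obtain ⟨c, hc, h | h⟩ := this
    · exact absurd ht h
    · exact h ▸ hc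
  refine (countable_iUnion fun n : ℕ => key (1 / ((n : ℝ) + 1)) (by positivity)).mono ?_
  intro t ht
  simp only [mem_iUnion, mem_ofPred_eq]
  by_contra! hcon
  refine ht (Metric.tendsto_nhds.mpr fun ε hε => ?_)
  obtain ⟨n, hn⟩ := exists_nat_one_div_lt hε
  filter_upwards [hcon n] with u hu using hu.trans hn

/-- The preimage of an open set exceeds its interior only by discontinuity points, which are
countable. -/
theorem IsRegulated.measurable [MeasurableSpace E] [BorelSpace E] (hw : IsRegulated w) :
    Measurable w := by
  refine measurable_of_isOpen fun O hO => ?_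
  have : w ⁻¹' O = interior (w ⁻¹' O) ∪ (w ⁻¹' O ∩ {t | ¬ ContinuousAt w t}) := by
    apply Subset.antisymm
    · intro t ht
      by_cases h : ContinuousAt w t
      · exact Or.inl (mem_interior_iff_mem_nhds.mpr (h.preimage_mem_nhds (hO.mem_nhds ht)))
      · exact Or.inr ⟨ht, h⟩
    · exact union_subset interior_subset inter_subset_left
  rw [this]
  exact isOpen_interior.measurableSet.union
    (hw.countable_not_continuousAt.mono inter_subset_right).measurableSet

end PseudoMetric

/-! ### An energy inequality for functions of bounded variation -/

section Energy

variable {F : Type*} [NormedAddCommGroup F] [InnerProductSpace ℝ F]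

theorem aestronglyMeasurable_integral_Iic {σ μ : Measure ℝ≥0} [SFinite σ] [SFinite μ]
    {M : ℝ≥0 → F} (hM : AEStronglyMeasurable M σ) :
    AEStronglyMeasurable (fun s => ∫ u in Iic s, M u ∂σ) μ := by
  have h : AEStronglyMeasurable ({p : ℝ≥0 × ℝ≥0 | p.2 ≤ p.1}.indicator fun p => M p.2)
      (μ.prod σ) :=
    hM.comp_snd.indicator (measurableSet_le measurable_snd measurable_fst)
  refine h.integral_prod_right'.congr (Eventually.of_forall fun s => ?_)
  simp only
  rw [← integral_indicator measurableSet_Iic]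
  rfl

variable [CompleteSpace F]

/-- The left side is the double integral of `⟨M u, M s⟩`. Each of the closed halves `u ≤ s` and `s ≤
u` contributes the integral on the right; their overlap, the diagonal, is counted twice but carries
the nonnegative integrand `‖M s‖²`. -/
theorem norm_sq_integral_le {σ : Measure ℝ≥0} [IsFiniteMeasure σ] {M : ℝ≥0 → F}
    (hM : Integrable M σ) :
    ‖∫ s, M s ∂σ‖ ^ 2 ≤ 2 * ∫ s, inner ℝ (∫ u in Iic s, M u ∂σ) (M s) ∂σ := by
  set f : ℝ≥0 × ℝ≥0 → ℝ := fun p => inner ℝ (M p.1) (M p.2) with hf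
  have hfi : Integrable f (σ.prod σ) :=
    hM.op_fst_snd (op := fun a b : F => inner ℝ a b) (by fun_prop)
      ⟨1, fun a b => by simpa using norm_inner_le_norm (𝕜 := ℝ) a b⟩ hM
  have hm : MeasurableSet {p : ℝ≥0 × ℝ≥0 | p.1 ≤ p.2} :=
    measurableSet_le measurable_fst measurable_snd
  have hm' : MeasurableSet {p : ℝ≥0 × ℝ≥0 | p.2 ≤ p.1} :=
    measurableSet_le measurable_snd measurable_fst
  have hfull : ∫ p, f p ∂(σ.prod σ) = ‖∫ s, M s ∂σ‖ ^ 2 := by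
    rw [integral_prod _ hfi, ← real_inner_self_eq_norm_sq]
    simp only [hf]
    have : ∀ x, ∫ y, inner ℝ (M x) (M y) ∂σ = inner ℝ (∫ y, M y ∂σ) (M x) := fun x => by
      rw [integral_inner hM, real_inner_comm]
    simp_rw [this]
    rw [integral_inner hM]
  have hA : ∫ p, {p : ℝ≥0 × ℝ≥0 | p.1 ≤ p.2}.indicator f p ∂(σ.prod σ) =
      ∫ s, inner ℝ (∫ u in Iic s, M u ∂σ) (M s) ∂σ := by
    rw [integral_prod_symm _ (hfi.indicator hm)]
    congr 1
    ext s
    have h1 : ∀ u, {p : ℝ≥0 × ℝ≥0 | p.1 ≤ p.2}.indicator f (u, s) =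
        (Iic s).indicator (fun u => inner ℝ (M s) (M u)) u := by
      intro u
      by_cases h : u ≤ s <;> simp [indicator, h, hf, real_inner_comm]
    simp_rw [h1]
    rw [integral_indicator measurableSet_Iic, integral_inner hM.integrableOn, real_inner_comm]
  have hB : ∫ p, {p : ℝ≥0 × ℝ≥0 | p.2 ≤ p.1}.indicator f p ∂(σ.prod σ) =
      ∫ s, inner ℝ (∫ u in Iic s, M u ∂σ) (M s) ∂σ := by
    rw [← hA, ← integral_prod_swap]
    congr 1
    ext p
    by_cases h : p.1 ≤ p.2 <;> simp [indicator, h, hf, real_inner_comm]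
  rw [← hfull, two_mul]
  nth_rewrite 1 [← hA]
  rw [← hB, ← integral_add (hfi.indicator hm) (hfi.indicator hm')]
  refine integral_mono hfi ((hfi.indicator hm).add (hfi.indicator hm')) fun p => ?_
  rcases lt_trichotomy p.1 p.2 with h | h | h
  · simp [indicator, h.le, h.not_ge]
  · have : 0 ≤ f p := by
      simp only [hf, h]
      exact real_inner_self_nonneg
    simp [indicator, h, this]
  · simp [indicator, h.le, h.not_ge]

/-- Both measures have densities with respect to `ν + ν'`, so the difference is a single integral to
which `norm_sq_integral_le` applies. -/
theorem norm_sq_integral_sub_integral_le {ν ν' : Measure ℝ≥0} [IsFiniteMeasure ν]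
    [IsFiniteMeasure ν'] {N N' : ℝ≥0 → F} (hN : Integrable N ν) (hN' : Integrable N' ν') :
    ‖∫ s, N s ∂ν - ∫ s, N' s ∂ν'‖ ^ 2 ≤
      2 * (∫ s, inner ℝ (∫ u in Iic s, N u ∂ν - ∫ u in Iic s, N' u ∂ν') (N s) ∂ν -
        ∫ s, inner ℝ (∫ u in Iic s, N u ∂ν - ∫ u in Iic s, N' u ∂ν') (N' s) ∂ν') := by
  set σ := ν + ν' with hσ
  have hac : ν ≪ σ := Measure.absolutelyContinuous_of_le (Measure.le_add_right le_rfl)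
  have hac' : ν' ≪ σ := Measure.absolutelyContinuous_of_le (Measure.le_add_left le_rfl)
  set a : ℝ≥0 → ℝ := fun s => (ν.rnDeriv σ s).toReal with ha
  set a' : ℝ≥0 → ℝ := fun s => (ν'.rnDeriv σ s).toReal with ha'
  have hi : Integrable (fun s => a s • N s) σ := (integrable_rnDeriv_smul_iff hac).mpr hN
  have hi' : Integrable (fun s => a' s • N' s) σ := (integrable_rnDeriv_smul_iff hac').mpr hN'
  set K : ℝ≥0 → F := fun s => ∫ u in Iic s, N u ∂ν - ∫ u in Iic s, N' u ∂ν' with hK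
  have hKM : ∀ s, ∫ u in Iic s, (a u • N u - a' u • N' u) ∂σ = K s := fun s => by
    rw [integral_sub hi.integrableOn hi'.integrableOn,
      setIntegral_rnDeriv_smul hac measurableSet_Iic,
      setIntegral_rnDeriv_smul hac' measurableSet_Iic]
  have htot : ∫ u, (a u • N u - a' u • N' u) ∂σ = ∫ s, N s ∂ν - ∫ s, N' s ∂ν' := by
    rw [integral_sub hi hi', integral_rnDeriv_smul hac, integral_rnDeriv_smul hac']
  have hKb : ∀ s, ‖K s‖ ≤ (∫ u, ‖N u‖ ∂ν) + ∫ u, ‖N' u‖ ∂ν' := fun s =>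
    (norm_sub_le _ _).trans (add_le_add
      ((norm_integral_le_integral_norm _).trans
        (setIntegral_le_integral hN.norm (Eventually.of_forall fun _ => norm_nonneg _)))
      ((norm_integral_le_integral_norm _).trans
        (setIntegral_le_integral hN'.norm (Eventually.of_forall fun _ => norm_nonneg _))))
  have hKm : ∀ μ : Measure ℝ≥0, IsFiniteMeasure μ → AEStronglyMeasurable K μ := fun μ _ =>
    (aestronglyMeasurable_integral_Iic hN.aestronglyMeasurable).sub
      (aestronglyMeasurable_integral_Iic hN'.aestronglyMeasurable)
  have hint : ∀ (μ : Measure ℝ≥0) (_ : IsFiniteMeasure μ) (G : ℝ≥0 → F), Integrable G μ →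
      Integrable (fun s => inner ℝ (K s) (G s)) μ := fun μ hμ G hG =>
    (hG.norm.const_mul ((∫ u, ‖N u‖ ∂ν) + ∫ u, ‖N' u‖ ∂ν')).mono'
      ((hKm μ hμ).inner hG.aestronglyMeasurable)
      (Eventually.of_forall fun s => (norm_inner_le_norm _ _).trans
        (mul_le_mul_of_nonneg_right (hKb s) (norm_nonneg _)))
  have h := norm_sq_integral_le (hi.sub hi')
  simp only [Pi.sub_apply] at h
  rw [htot] at h
  simp_rw [hKM, inner_sub_right] at h
  rw [integral_sub (hint σ inferInstance _ hi) (hint σ inferInstance _ hi')] at h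
  have e1 : ∫ s, inner ℝ (K s) (a s • N s) ∂σ = ∫ s, inner ℝ (K s) (N s) ∂ν := by
    rw [← integral_rnDeriv_smul hac]
    simp_rw [inner_smul_right, smul_eq_mul, ha]
  have e2 : ∫ s, inner ℝ (K s) (a' s • N' s) ∂σ = ∫ s, inner ℝ (K s) (N' s) ∂ν' := by
    rw [← integral_rnDeriv_smul hac']
    simp_rw [inner_smul_right, smul_eq_mul, ha']
  rwa [e1, e2] at h

end Energy

/-! ### The inward normal and the metric projection of a convex domain -/

section Geometry

variable {d : ℕ} {D : Set (EuclideanSpace ℝ (Fin d))}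

theorem isInwardUnitNormal_inwardNormal (hD : IsBoundedConvexC2Domain D)
    {x : EuclideanSpace ℝ (Fin d)} (hx : x ∈ frontier D) :
    IsInwardUnitNormal D x (inwardNormal D x) := by
  rw [inwardNormal, if_pos hx]
  exact Classical.epsilon_spec (existsUnique_isInwardUnitNormal hD hx).exists

theorem IsInwardUnitNormal.eq_inwardNormal (hD : IsBoundedConvexC2Domain D)
    {x v : EuclideanSpace ℝ (Fin d)} (hx : x ∈ frontier D) (hv : IsInwardUnitNormal D x v) :
    v = inwardNormal D x :=
  (existsUnique_isInwardUnitNormal hD hx).unique hv (isInwardUnitNormal_inwardNormal hD hx)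

theorem norm_inwardNormal (hD : IsBoundedConvexC2Domain D)
    {x : EuclideanSpace ℝ (Fin d)} (hx : x ∈ frontier D) : ‖inwardNormal D x‖ = 1 :=
  (isInwardUnitNormal_inwardNormal hD hx).1

theorem norm_inwardNormal_le_one (hD : IsBoundedConvexC2Domain D)
    (x : EuclideanSpace ℝ (Fin d)) : ‖inwardNormal D x‖ ≤ 1 := by
  by_cases hx : x ∈ frontier D
  · exact (norm_inwardNormal hD hx).le
  · rw [inwardNormal, if_neg hx]; simp

theorem inner_inwardNormal_nonneg (hD : IsBoundedConvexC2Domain D)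
    (x : EuclideanSpace ℝ (Fin d)) {z : EuclideanSpace ℝ (Fin d)} (hz : z ∈ closure D) :
    0 ≤ inner ℝ (z - x) (inwardNormal D x) := by
  by_cases hx : x ∈ frontier D
  · exact (isInwardUnitNormal_inwardNormal hD hx).2 z hz
  · rw [inwardNormal, if_neg hx]; simp

/-- The normals stay in a compact ball, and any cluster value at `x` along the boundary is again an
inward unit normal at `x`. Uniqueness of that normal, where smoothness of the boundary enters,
leaves only one cluster value. -/
theorem continuousOn_inwardNormal (hD : IsBoundedConvexC2Domain D) :
    ContinuousOn (inwardNormal D) (frontier D) := by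
  intro x hx
  have hmem : ∀ᶠ p in 𝓝[frontier D] x, p ∈ frontier D := self_mem_nhdsWithin
  refine (isCompact_closedBall (0 : EuclideanSpace ℝ (Fin d)) 1).tendsto_nhds_of_unique_mapClusterPt
    (Eventually.of_forall fun p => by simpa using norm_inwardNormal_le_one hD p) ?_
  intro v _ hv
  obtain ⟨U, hU, hUv⟩ := mapClusterPt_iff_ultrafilter.mp hv
  refine IsInwardUnitNormal.eq_inwardNormal hD hx ⟨?_, fun z hz => ?_⟩
  · refine tendsto_nhds_unique hUv.norm (tendsto_const_nhds.congr' ?_)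
    filter_upwards [hU hmem] with p hp using (norm_inwardNormal hD hp).symm
  · have hid : Tendsto (fun p => p) (U : Filter (EuclideanSpace ℝ (Fin d))) (𝓝 x) :=
      tendsto_id.mono_left (hU.trans nhdsWithin_le_nhds)
    exact ge_of_tendsto ((hid.const_sub z).inner hUv)
      (Eventually.of_forall fun p => inner_inwardNormal_nonneg hD p hz)

/-- Tietze extension. It is needed because the limit path may be inside `D` at times when the
approximating paths are on the boundary. -/
theorem exists_continuous_eq_inwardNormal (hD : IsBoundedConvexC2Domain D) :
    ∃ ν : EuclideanSpace ℝ (Fin d) → EuclideanSpace ℝ (Fin d),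
      Continuous ν ∧ ∀ x ∈ frontier D, ν x = inwardNormal D x := by
  obtain ⟨G, hG⟩ := ContinuousMap.exists_restrict_eq (isClosed_frontier (s := D))
    ⟨_, (continuousOn_inwardNormal hD).domRestrict⟩
  exact ⟨G, G.continuous, fun x hx => congrArg (fun h => h ⟨x, hx⟩) hG⟩

theorem measurable_inwardNormal (hD : IsBoundedConvexC2Domain D) :
    Measurable (inwardNormal D) := by
  obtain ⟨ν, hν, hνD⟩ := exists_continuous_eq_inwardNormal hD
  have : inwardNormal D = (frontier D).indicator ν := by
    ext1 x
    by_cases hx : x ∈ frontier D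
    · rw [indicator_of_mem hx, hνD x hx]
    · rw [indicator_of_notMem hx, inwardNormal, if_neg hx]
  rw [this]
  exact hν.measurable.indicator isClosed_frontier.measurableSet

/-- If the closed ball of radius `r` about `a` lies in `D`, the point `a - r n(p)` is still on the
inner side of the supporting hyperplane at `p`. -/
theorem exists_le_inner_inwardNormal (hD : IsBoundedConvexC2Domain D) :
    ∃ (a : EuclideanSpace ℝ (Fin d)) (r R : ℝ), 0 < r ∧ (∀ z ∈ closure D, ‖z - a‖ ≤ R) ∧
      ∀ p ∈ frontier D, r ≤ inner ℝ (a - p) (inwardNormal D p) := by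
  obtain ⟨a, ha⟩ := hD.nonempty
  obtain ⟨r, hr, hball⟩ := Metric.nhds_basis_closedBall.mem_iff.mp (hD.isOpen.mem_nhds ha)
  obtain ⟨R, hR⟩ := hD.bounded.closure.subset_closedBall a
  refine ⟨a, r, R, hr, fun z hz => by simpa [dist_eq_norm] using hR hz, fun p hp => ?_⟩
  have h1 := norm_inwardNormal hD hp
  have hz : a - r • inwardNormal D p ∈ closure D :=
    subset_closure (hball (by simp [norm_smul, h1, abs_of_pos hr]))
  have := inner_inwardNormal_nonneg hD p hz
  rw [show a - r • inwardNormal D p - p = (a - p) - r • inwardNormal D p by abel,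
    inner_sub_left, real_inner_smul_left, real_inner_self_eq_norm_sq, h1] at this
  linarith

theorem isMetricProj_metricProj (hD : IsBoundedConvexC2Domain D)
    (x : EuclideanSpace ℝ (Fin d)) : IsMetricProj D x (metricProj D x) :=
  Classical.epsilon_spec (existsUnique_isMetricProj hD x).exists

theorem IsMetricProj.metricProj_eq (hD : IsBoundedConvexC2Domain D)
    {x p : EuclideanSpace ℝ (Fin d)} (h : IsMetricProj D x p) : metricProj D x = p :=
  (existsUnique_isMetricProj hD x).unique (isMetricProj_metricProj hD x) h

/-- The supporting hyperplane at `x` keeps every point of the closure at distance at least `r` from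
`x - r n(x)`. This evaluates the projection inside `gBar`. -/
theorem metricProj_sub_smul_inwardNormal (hD : IsBoundedConvexC2Domain D)
    {x : EuclideanSpace ℝ (Fin d)} (hx : x ∈ frontier D) {r : ℝ} (hr : 0 ≤ r) :
    metricProj D (x - r • inwardNormal D x) = x := by
  have h1 := norm_inwardNormal hD hx
  have hd : dist (x - r • inwardNormal D x) x = r := by
    simp [norm_smul, h1, abs_of_nonneg hr]
  refine IsMetricProj.metricProj_eq hD ⟨frontier_subset_closure hx, ?_⟩
  refine le_antisymm ?_ (Metric.infDist_le_dist_of_mem (frontier_subset_closure hx))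
  refine (Metric.le_infDist hD.nonempty.closure).mpr fun z hz => ?_
  rw [hd, dist_comm, dist_eq_norm,
    show z - (x - r • inwardNormal D x) = (z - x) + r • inwardNormal D x by abel]
  have h2 := inner_inwardNormal_nonneg hD x hz
  have h3 := real_inner_le_norm ((z - x) + r • inwardNormal D x) (inwardNormal D x)
  rw [inner_add_left, real_inner_smul_left, real_inner_self_eq_norm_sq, h1] at h3
  linarith

theorem inner_metricProj_sub_nonneg (hD : IsBoundedConvexC2Domain D)
    (y : EuclideanSpace ℝ (Fin d)) {z : EuclideanSpace ℝ (Fin d)} (hz : z ∈ closure D) :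
    0 ≤ inner ℝ (z - metricProj D y) (metricProj D y - y) := by
  have hp := isMetricProj_metricProj hD y
  have h := (norm_eq_iInf_iff_real_inner_le_zero hD.convex.closure (u := y) hp.1).mp (by
    rw [← dist_eq_norm, hp.2, Metric.infDist_eq_iInf]
    simp_rw [dist_eq_norm]) z hz
  rw [real_inner_comm, ← neg_sub, inner_neg_left] at h
  rw [← neg_sub y, inner_neg_right]
  have h' : inner ℝ (metricProj D y - z) (y - metricProj D y) =
    - inner ℝ (z - metricProj D y) (y - metricProj D y) := by rw [← neg_sub, inner_neg_left]
  linarith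

theorem metricProj_mem_frontier (hD : IsBoundedConvexC2Domain D)
    {y : EuclideanSpace ℝ (Fin d)} (hy : metricProj D y ≠ y) :
    metricProj D y ∈ frontier D := by
  have hp := (isMetricProj_metricProj hD y).1
  rw [hD.isOpen.frontier_eq]
  refine ⟨hp, fun hpD => ?_⟩
  obtain ⟨r, hr, hball⟩ := Metric.nhds_basis_closedBall.mem_iff.mp (hD.isOpen.mem_nhds hpD)
  set v := metricProj D y - y with hv
  have hv0 : 0 < ‖v‖ := norm_pos_iff.mpr (sub_ne_zero.mpr hy)
  have hz : metricProj D y - (r / ‖v‖) • v ∈ closure D :=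
    subset_closure (hball (by
      rw [mem_closedBall_iff_norm, sub_sub_cancel_left, norm_neg, norm_smul, norm_div, norm_norm,
        div_mul_cancel₀ _ hv0.ne', Real.norm_of_nonneg hr.le]))
  have h := inner_metricProj_sub_nonneg hD y hz
  rw [sub_sub_cancel_left, ← hv, inner_neg_left, real_inner_smul_left,
    real_inner_self_eq_norm_sq] at h
  have : 0 < r / ‖v‖ * ‖v‖ ^ 2 := by positivity
  linarith

/-- Consequently the initial push `k 0` obeys the same normal-reflection rule as later jumps and can
be treated as an atom at time `0`. -/
theorem metricProj_sub_eq (hD : IsBoundedConvexC2Domain D) (y : EuclideanSpace ℝ (Fin d)) :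
    metricProj D y - y = ‖metricProj D y - y‖ • inwardNormal D (metricProj D y) := by
  by_cases hy : metricProj D y = y
  · simp [hy]
  have hv0 : 0 < ‖metricProj D y - y‖ := norm_pos_iff.mpr (sub_ne_zero.mpr hy)
  rw [← IsInwardUnitNormal.eq_inwardNormal hD (metricProj_mem_frontier hD hy)
    (v := ‖metricProj D y - y‖⁻¹ • (metricProj D y - y)) ⟨?_, fun z hz => ?_⟩,
    smul_inv_smul₀ hv0.ne']
  · rw [norm_smul, norm_inv, norm_norm, inv_mul_cancel₀ hv0.ne']
  · rw [real_inner_smul_right]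
    exact mul_nonneg (inv_nonneg.mpr hv0.le) (inner_metricProj_sub_nonneg hD y hz)

end Geometry

/-! ### Reflected paths -/

/-- A non-integrable `f` has integral `0` by convention; the condition `0 ≤ c` covers that case and
spares any integrability check. -/
theorem integral_le_of_ae_le {α : Type*} [MeasurableSpace α] {μ : Measure α} [IsFiniteMeasure μ]
    {f : α → ℝ} {c : ℝ} (hc : 0 ≤ c) (h : ∀ᵐ s ∂μ, f s ≤ c) : ∫ s, f s ∂μ ≤ c * μ.real univ := by
  by_cases hf : Integrable f μ
  · refine (integral_mono_ae hf (integrable_const c) h).trans_eq ?_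
    simp [mul_comm]
  · rw [integral_undef hf]
    positivity

/-- `x = y + k` is a path in the closure of `D` whose reflection term `k` is the integral of the
inward normal against a measure `ν` which is carried by the times where `x` is on the boundary. -/
structure ReflectedPath {d : ℕ} (D : Set (EuclideanSpace ℝ (Fin d)))
    (y x k : ℝ≥0 → EuclideanSpace ℝ (Fin d)) (ν : Measure ℝ≥0) : Prop where
  measurable : Measurable x
  eq_add : ∀ t, x t = y t + k t
  mem_closure : ∀ t, x t ∈ closure D
  measure_Iic_lt_top : ∀ t, ν (Iic t) < ∞
  ae_mem_frontier : ∀ᵐ s ∂ν, x s ∈ frontier D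
  eq_integral : ∀ t, k t = ∫ s in Iic t, inwardNormal D (x s) ∂ν

namespace ReflectedPath

variable {d : ℕ} {D : Set (EuclideanSpace ℝ (Fin d))}
  {y x k y' x' k' : ℝ≥0 → EuclideanSpace ℝ (Fin d)} {ν ν' : Measure ℝ≥0}

theorem comp_orderIso (h : ReflectedPath D y x k ν) (e : ℝ≥0 ≃o ℝ≥0) :
    ReflectedPath D (y ∘ e) (x ∘ e) (k ∘ e) (ν.map e.symm) := by
  have hme : Measurable e := e.continuous.measurable
  have hms : Measurable e.symm := e.symm.continuous.measurable
  have hemb : MeasurableEmbedding e.symm := e.symm.toHomeomorph.measurableEmbedding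
  have hpre : ∀ t, e.symm ⁻¹' Iic t = Iic (e t) := fun t => by
    ext s; simp
  refine ⟨h.measurable.comp hme, fun t => h.eq_add _, fun t => h.mem_closure _, fun t => ?_, ?_,
    fun t => ?_⟩
  · rw [hemb.map_apply, hpre]
    exact h.measure_Iic_lt_top _
  · rw [hemb.ae_map_iff]
    filter_upwards [h.ae_mem_frontier] with s hs
    simpa using hs
  · rw [hemb.setIntegral_map, hpre, Function.comp_apply, h.eq_integral]
    simp

theorem isFiniteMeasure_restrict (h : ReflectedPath D y x k ν) {S : Set ℝ≥0} {t : ℝ≥0}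
    (hS : S ⊆ Iic t) : IsFiniteMeasure (ν.restrict S) :=
  ⟨by rw [Measure.restrict_apply_univ]; exact (measure_mono hS).trans_lt (h.measure_Iic_lt_top t)⟩

theorem measure_ne_top (h : ReflectedPath D y x k ν) {S : Set ℝ≥0} {t : ℝ≥0}
    (hS : S ⊆ Iic t) : ν S ≠ ∞ :=
  ((measure_mono hS).trans_lt (h.measure_Iic_lt_top t)).ne

theorem isLocallyFiniteMeasure (h : ReflectedPath D y x k ν) : IsLocallyFiniteMeasure ν :=
  ⟨fun t => ⟨Iic (t + 1), Iic_mem_nhds (lt_add_one t), h.measure_Iic_lt_top _⟩⟩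

theorem ae_norm_eq_one (hD : IsBoundedConvexC2Domain D) (h : ReflectedPath D y x k ν) :
    ∀ᵐ s ∂ν, ‖inwardNormal D (x s)‖ = 1 := by
  filter_upwards [h.ae_mem_frontier] with s hs using norm_inwardNormal hD hs

theorem integrableOn (hD : IsBoundedConvexC2Domain D) (h : ReflectedPath D y x k ν)
    {S : Set ℝ≥0} {t : ℝ≥0} (hS : S ⊆ Iic t) :
    IntegrableOn (fun s => inwardNormal D (x s)) S ν := by
  have := h.isFiniteMeasure_restrict hS
  exact (integrable_const (1 : ℝ)).mono'
    ((measurable_inwardNormal hD).comp h.measurable).aestronglyMeasurable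
    (Eventually.of_forall fun s => norm_inwardNormal_le_one hD _)

theorem sub_eq_integral_Ioc (hD : IsBoundedConvexC2Domain D) (h : ReflectedPath D y x k ν)
    {s t : ℝ≥0} (hst : s ≤ t) : k t - k s = ∫ u in Ioc s t, inwardNormal D (x u) ∂ν := by
  rw [h.eq_integral, h.eq_integral, ← Iic_union_Ioc_eq_Iic hst,
    setIntegral_union (Iic_disjoint_Ioc le_rfl) measurableSet_Ioc
      (h.integrableOn hD (Iic_subset_Iic.mpr hst)) (h.integrableOn hD Ioc_subset_Iic_self),
    add_sub_cancel_left]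

theorem sub_integral_Iio (hD : IsBoundedConvexC2Domain D) (h : ReflectedPath D y x k ν)
    (t : ℝ≥0) : k t - ∫ u in Iio t, inwardNormal D (x u) ∂ν =
      ν.real {t} • inwardNormal D (x t) := by
  rw [h.eq_integral, ← Iio_union_right,
    setIntegral_union (by simp) (measurableSet_singleton t)
      (h.integrableOn hD Iio_subset_Iic_self)
      (h.integrableOn hD (singleton_subset_iff.mpr (mem_Iic.mpr le_rfl))),
    add_sub_cancel_left, integral_singleton]

/-- If `t` is an atom then `x t` is on the boundary and the normal is a unit vector; otherwise both
sides vanish. -/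
theorem norm_real_smul_inwardNormal (hD : IsBoundedConvexC2Domain D)
    (h : ReflectedPath D y x k ν) (t : ℝ≥0) :
    ‖ν.real {t} • inwardNormal D (x t)‖ = ν.real {t} := by
  by_cases ht : ν {t} = 0
  · simp [measureReal_def, ht]
  · have h1 : ‖inwardNormal D (x t)‖ = 1 := by
      by_contra hcon
      exact ht (measure_mono_null (singleton_subset_iff.mpr hcon)
        (ae_iff.mp (h.ae_norm_eq_one hD)))
    rw [norm_smul, h1, mul_one, Real.norm_of_nonneg measureReal_nonneg]

/-- Identifies `k_{t-}`; with `sub_integral_Iio` this makes `ν.real {t} • inwardNormal D (x t)` the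
jump of `k`. -/
theorem tendsto_integral_Iio (hD : IsBoundedConvexC2Domain D) (h : ReflectedPath D y x k ν)
    (t : ℝ≥0) : Tendsto k (𝓝[<] t) (𝓝 (∫ u in Iio t, inwardNormal D (x u) ∂ν)) := by
  have := h.isFiniteMeasure_restrict (Iio_subset_Iic_self (a := t))
  have key : Tendsto (fun s => ∫ u in Iio t, (Iic s).indicator (fun u => inwardNormal D (x u)) u ∂ν)
      (𝓝[<] t) (𝓝 (∫ u in Iio t, inwardNormal D (x u) ∂ν)) := by
    refine tendsto_integral_filter_of_dominated_convergence (fun _ => 1)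
      (Eventually.of_forall fun s =>
        (((measurable_inwardNormal hD).comp h.measurable).indicator
          measurableSet_Iic).aestronglyMeasurable)
      (Eventually.of_forall fun s => Eventually.of_forall fun u =>
        (norm_indicator_le_norm_self _ _).trans (norm_inwardNormal_le_one hD _))
      (integrable_const _) ?_
    filter_upwards [ae_restrict_mem measurableSet_Iio] with u hu
    refine tendsto_const_nhds.congr' ?_
    filter_upwards [Ioo_mem_nhdsLT hu] with s hs
    rw [indicator_of_mem (mem_Iic.mpr hs.1.le)]
  refine key.congr' ?_
  filter_upwards [self_mem_nhdsWithin] with s hs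
  rw [integral_indicator measurableSet_Iic, Measure.restrict_restrict measurableSet_Iic,
    inter_eq_left.mpr (Iic_subset_Iio.mpr hs), h.eq_integral]

/-- In the energy inequality, `k - k'` splits as `(x - x') - (y - y')`. Convexity gives the first
part the favourable sign against both normals, and the second costs at most `δ` per unit of mass. -/
theorem norm_sub_sq_le (hD : IsBoundedConvexC2Domain D) (h : ReflectedPath D y x k ν)
    (h' : ReflectedPath D y' x' k' ν') {t : ℝ≥0} {δ : ℝ}
    (hδ : ∀ s ≤ t, ‖y s - y' s‖ ≤ δ) :
    ‖k t - k' t‖ ^ 2 ≤ 2 * δ * (ν.real (Iic t) + ν'.real (Iic t)) := by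
  have hδ0 : 0 ≤ δ := (norm_nonneg _).trans (hδ t le_rfl)
  have hf := h.isFiniteMeasure_restrict (Subset.refl (Iic t))
  have hf' := h'.isFiniteMeasure_restrict (Subset.refl (Iic t))
  have key := norm_sq_integral_sub_integral_le (h.integrableOn hD (Subset.refl (Iic t)))
    (h'.integrableOn hD (Subset.refl (Iic t)))
  -- The measures are restricted to `Iic t`, so the inner partial integrals are values at `s ⊓ t`.
  simp_rw [Measure.restrict_restrict measurableSet_Iic, Iic_inter_Iic, ← h.eq_integral,
    ← h'.eq_integral] at key
  have hcs : ∀ s ≤ t, ∀ v : EuclideanSpace ℝ (Fin d), ‖v‖ ≤ 1 →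
      |inner ℝ (y s - y' s) v| ≤ δ := fun s hs v hv =>
    (abs_real_inner_le_norm _ _).trans ((mul_le_mul (hδ s hs) hv (norm_nonneg _) hδ0).trans_eq
      (mul_one _))
  have hdec : ∀ s, k s - k' s = (x s - x' s) - (y s - y' s) := fun s => by
    rw [h.eq_add, h'.eq_add]; abel
  have e1 : ∫ s in Iic t, inner ℝ (k (s ⊓ t) - k' (s ⊓ t)) (inwardNormal D (x s)) ∂ν ≤
      δ * ν.real (Iic t) := by
    refine (integral_le_of_ae_le hδ0 ?_).trans_eq (by simp)
    filter_upwards [ae_restrict_mem measurableSet_Iic] with s hs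
    rw [inf_eq_left.mpr hs, hdec, inner_sub_left, ← neg_sub (x' s), inner_neg_left]
    have := inner_inwardNormal_nonneg hD (x s) (h'.mem_closure s)
    have := (abs_le.mp (hcs s hs _ (norm_inwardNormal_le_one hD (x s)))).1
    linarith
  have e2 : ∫ s in Iic t, - inner ℝ (k (s ⊓ t) - k' (s ⊓ t)) (inwardNormal D (x' s)) ∂ν' ≤
      δ * ν'.real (Iic t) := by
    refine (integral_le_of_ae_le hδ0 ?_).trans_eq (by simp)
    filter_upwards [ae_restrict_mem measurableSet_Iic] with s hs
    rw [inf_eq_left.mpr hs, hdec, inner_sub_left]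
    have := inner_inwardNormal_nonneg hD (x' s) (h.mem_closure s)
    have := (abs_le.mp (hcs s hs _ (norm_inwardNormal_le_one hD (x' s)))).2
    linarith
  rw [integral_neg] at e2
  linarith

/-- With `X` the increment of `k` over the open interval, the energy inequality reads `‖X‖² ≤ 2 ∫ ⟨k
u - k s, n(x u)⟩ dν`. Writing `k u - k s = (x u - a) - (x s - a) - (y u - y s)`, the first term
contributes at most `-r` per unit of mass, the last at most `r / 2`, and the middle one integrates
to at most `R ‖X‖`. -/
theorem mul_real_Ioo_le (hD : IsBoundedConvexC2Domain D) (h : ReflectedPath D y x k ν)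
    {a : EuclideanSpace ℝ (Fin d)} {r R : ℝ} (hR : ∀ z ∈ closure D, ‖z - a‖ ≤ R)
    (ha : ∀ p ∈ frontier D, r ≤ inner ℝ (a - p) (inwardNormal D p)) {s t : ℝ≥0}
    (hy : ∀ u ∈ Ioo s t, ‖y u - y s‖ ≤ r / 2) : r * ν.real (Ioo s t) ≤ R ^ 2 := by
  have hsub : Ioo s t ⊆ Iic t := fun u hu => hu.2.le
  have hfin := h.isFiniteMeasure_restrict hsub
  have hN := h.integrableOn hD hsub
  set X := ∫ u in Ioo s t, inwardNormal D (x u) ∂ν with hX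
  have key := norm_sq_integral_le hN
  have hle : ∫ u in Ioo s t, (inner ℝ (∫ v in Iic u, inwardNormal D (x v) ∂ν.restrict (Ioo s t))
      (inwardNormal D (x u)) - inner ℝ (a - x s) (inwardNormal D (x u)) + r / 2) ∂ν ≤ 0 := by
    refine (integral_le_of_ae_le le_rfl ?_).trans_eq (zero_mul _)
    filter_upwards [ae_restrict_mem measurableSet_Ioo, ae_restrict_of_ae h.ae_mem_frontier]
      with u hu hxu
    have hset : Iic u ∩ Ioo s t = Ioc s u := by
      ext v
      simp only [mem_inter_iff, mem_Iic, mem_Ioo, mem_Ioc]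
      exact ⟨fun hv => ⟨hv.2.1, hv.1⟩, fun hv => ⟨hv.2, hv.1, hv.2.trans_lt hu.2⟩⟩
    rw [Measure.restrict_restrict measurableSet_Iic, hset, ← h.sub_eq_integral_Ioc hD hu.1.le]
    have hdec : k u - k s = -(a - x u) + (a - x s) - (y u - y s) := by
      rw [h.eq_add, h.eq_add]; abel
    rw [hdec, inner_sub_left, inner_add_left, inner_neg_left]
    have h1 := ha _ hxu
    have h2 : |inner ℝ (y u - y s) (inwardNormal D (x u))| ≤ r / 2 :=
      (abs_real_inner_le_norm _ _).trans (by
        rw [norm_inwardNormal hD hxu, mul_one]; exact hy u hu)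
    have := (abs_le.mp h2).1
    linarith
  have hi1 : Integrable (fun u => inner ℝ (∫ v in Iic u, inwardNormal D (x v) ∂ν.restrict (Ioo s t))
      (inwardNormal D (x u))) (ν.restrict (Ioo s t)) := by
    refine (integrable_const ((ν.restrict (Ioo s t)).real univ)).mono'
      ((aestronglyMeasurable_integral_Iic hN.aestronglyMeasurable).inner hN.aestronglyMeasurable)
      (Eventually.of_forall fun u => (norm_inner_le_norm _ _).trans ?_)
    refine (mul_le_of_le_one_right (norm_nonneg _) (norm_inwardNormal_le_one hD _)).trans ?_
    refine (norm_setIntegral_le_of_norm_le_const (C := 1) (measure_lt_top _ _)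
      (fun v _ => norm_inwardNormal_le_one hD _)).trans ?_
    rw [one_mul]
    exact measureReal_mono (subset_univ _)
  have hi2 : Integrable (fun u => inner ℝ (a - x s) (inwardNormal D (x u)))
      (ν.restrict (Ioo s t)) := hN.const_inner _
  have hadd := integral_add (hi1.sub hi2) (integrable_const (r / 2))
  simp only [Pi.sub_apply] at hadd
  rw [hadd, integral_sub hi1 hi2, integral_inner hN, ← hX] at hle
  simp only [integral_const, measureReal_restrict_apply_univ, smul_eq_mul] at hle
  have h3 : inner ℝ (a - x s) X ≤ R * ‖X‖ :=
    (real_inner_le_norm _ _).trans (mul_le_mul_of_nonneg_right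
      (by rw [norm_sub_rev]; exact hR _ (h.mem_closure s)) (norm_nonneg _))
  -- Now `‖X‖² ≤ 2 R ‖X‖ - r ν(s, t)`; complete the square.
  nlinarith [sq_nonneg (R - ‖X‖)]

end ReflectedPath

/-! ### Stability of reflected paths under locally uniform convergence -/

namespace ReflectedPath

variable {d : ℕ} {D : Set (EuclideanSpace ℝ (Fin d))}
  {yn xn kn : ℕ → ℝ≥0 → EuclideanSpace ℝ (Fin d)} {νn : ℕ → Measure ℝ≥0}
  {y x k : ℝ≥0 → EuclideanSpace ℝ (Fin d)} {ν : Measure ℝ≥0}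

theorem norm_integral_Iio_sub_le (hD : IsBoundedConvexC2Domain D)
    {y x k y' x' k' : ℝ≥0 → EuclideanSpace ℝ (Fin d)} {ν ν' : Measure ℝ≥0}
    (h : ReflectedPath D y x k ν) (h' : ReflectedPath D y' x' k' ν') {t : ℝ≥0} {ε : ℝ}
    (hε : 0 ≤ ε) (hk : ∀ᶠ s in 𝓝[<] t, ‖k s - k' s‖ ≤ ε) :
    ‖∫ u in Iio t, inwardNormal D (x u) ∂ν - ∫ u in Iio t, inwardNormal D (x' u) ∂ν'‖ ≤ ε := by
  rcases eq_zero_or_pos t with rfl | ht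
  · simpa using hε
  have : (𝓝[<] t).NeBot := nhdsLT_neBot_of_exists_lt ⟨0, ht⟩
  exact le_of_tendsto ((h.tendsto_integral_Iio hD t).sub (h'.tendsto_integral_Iio hD t)).norm hk

/-- The mass of an atom is the norm of a jump of `k = x - y`, where `x` is bounded and `yn` is
eventually within `1` of `y`. -/
theorem eventually_real_singleton_le (hD : IsBoundedConvexC2Domain D)
    (h : ∀ n, ReflectedPath D (yn n) (xn n) (kn n) (νn n)) (hy : IsCadlag y)
    (hlim : ∀ N, TendstoUniformlyOn yn y atTop (Icc 0 N)) (t : ℝ≥0) :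
    ∃ C : ℝ, ∀ᶠ n in atTop, (νn n).real {t} ≤ C := by
  obtain ⟨R, hR⟩ := hD.bounded.closure.exists_norm_le
  obtain ⟨l, hl⟩ := (hy t).2
  -- `R` bounds the domain, the bracket bounds `y` at `t` and just before it, and the last `1` is
  -- the distance from `yn` to `y`.
  set B : ℝ := |R| + (max ‖l‖ ‖y t‖ + 1) + 1 with hB
  refine ⟨B + B, ?_⟩
  filter_upwards [Metric.tendstoUniformlyOn_iff.mp (hlim t) 1 one_pos] with n hn
  have hk : ∀ s ≤ t, ‖y s‖ ≤ max ‖l‖ ‖y t‖ + 1 → ‖kn n s‖ ≤ B := by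
    intro s hs hys
    have e : kn n s = xn n s - y s + (y s - yn n s) := by rw [(h n).eq_add]; abel
    have h1 := hn s ⟨bot_le, hs⟩
    rw [dist_eq_norm] at h1
    have h2 := (hR _ ((h n).mem_closure s)).trans (le_abs_self R)
    rw [e]
    refine (norm_add_le _ _).trans ?_
    have := norm_sub_le (xn n s) (y s)
    linarith
  have h1 : ‖kn n t‖ ≤ B := hk t le_rfl (by linarith [le_max_right ‖l‖ ‖y t‖])
  have h2 : ‖∫ u in Iio t, inwardNormal D (xn n u) ∂(νn n)‖ ≤ B := by
    rcases eq_zero_or_pos t with rfl | ht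
    · have : 0 ≤ B := by positivity
      simpa using this
    have : (𝓝[<] t).NeBot := nhdsLT_neBot_of_exists_lt ⟨0, ht⟩
    refine le_of_tendsto ((h n).tendsto_integral_Iio hD t).norm ?_
    filter_upwards [self_mem_nhdsWithin,
      hl.norm.eventually (gt_mem_nhds (lt_add_one ‖l‖))] with s hs hys
    exact hk s (le_of_lt hs) (by linarith [le_max_left ‖l‖ ‖y t‖])
  rw [← (h n).norm_real_smul_inwardNormal hD, ← (h n).sub_integral_Iio hD]
  exact (norm_sub_le _ _).trans (add_le_add h1 h2)

/-- Real induction: open intervals of small oscillation have mass at most `R ^ 2 / r`, and the atom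
at the right end is bounded separately. -/
theorem eventually_real_Iic_le (hD : IsBoundedConvexC2Domain D)
    (h : ∀ n, ReflectedPath D (yn n) (xn n) (kn n) (νn n)) (hy : IsCadlag y)
    (hlim : ∀ N, TendstoUniformlyOn yn y atTop (Icc 0 N)) (t : ℝ≥0) :
    ∃ C : ℝ, ∀ᶠ n in atTop, (νn n).real (Iic t) ≤ C := by
  obtain ⟨a, r, R, hr, hR, ha⟩ := exists_le_inner_inwardNormal hD
  -- Oscillation `r / 4` of `y` plus twice the error `r / 8` of `yn` gives the admissible `r / 2`.
  have hloc : ∀ s t : ℝ≥0, (∀ u ∈ Ioo s t, ‖y u - y s‖ ≤ r / 4) →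
      ∀ᶠ n in atTop, (νn n).real (Ioo s t) ≤ R ^ 2 / r := by
    intro s t hst
    filter_upwards [Metric.tendstoUniformlyOn_iff.mp (hlim (max s t)) (r / 8) (by positivity)]
      with n hn
    rw [le_div_iff₀' hr]
    refine (h n).mul_real_Ioo_le hD hR ha fun u hu => ?_
    have h1 := hn u ⟨bot_le, hu.2.le.trans (le_max_right _ _)⟩
    have h2 := hn s ⟨bot_le, le_max_left _ _⟩
    rw [dist_comm] at h1
    have h3 := hst u hu
    rw [← dist_eq_norm] at h3 ⊢
    linarith [dist_triangle4 (yn n u) (y u) (y s) (yn n s)]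
  induction t using NNReal.real_induction with
  | h0 =>
    obtain ⟨C, hC⟩ := eventually_real_singleton_le hD h hy hlim 0
    have : Iic (0 : ℝ≥0) = {0} := by ext; simp
    exact ⟨C, this ▸ hC⟩
  | hr t ht =>
    obtain ⟨C, hC⟩ := ht
    obtain ⟨u, hu, hyu⟩ := exists_Ioo_of_eventually_nhdsGT
      (Metric.tendsto_nhds.mp ((hy t).1.tendsto.mono_left (nhdsWithin_mono t Ioi_subset_Ici_self))
        (r / 4) (by positivity))
    refine ⟨u, hu, fun s hs => ⟨C + R ^ 2 / r, ?_⟩⟩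
    filter_upwards [hC, hloc t u fun v hv => by rw [← dist_eq_norm]; exact (hyu v hv).le]
      with n h1 h2
    refine (measureReal_mono (s₂ := Iic t ∪ Ioo t u) (fun v hv => ?_)
      ((h n).measure_ne_top (t := u) ?_)).trans ((measureReal_union_le _ _).trans (add_le_add h1 h2))
    · rcases le_or_gt v t with hvt | hvt
      · exact Or.inl hvt
      · exact Or.inr ⟨hvt, (mem_Iic.mp hv).trans_lt hs.2⟩
    · exact union_subset (Iic_subset_Iic.mpr hu.le) fun v hv => hv.2.le
  | hl t ht hlt =>
    obtain ⟨l, hl⟩ := (hy t).2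
    obtain ⟨b, hb, hyb⟩ := exists_Ioo_of_eventually_nhdsLT ht
      (Metric.tendsto_nhds.mp hl (r / 8) (by positivity))
    obtain ⟨s, hbs, hst⟩ := exists_between hb
    obtain ⟨C, hC⟩ := hlt s hst
    obtain ⟨C', hC'⟩ := eventually_real_singleton_le hD h hy hlim t
    refine ⟨C + R ^ 2 / r + C', ?_⟩
    have hosc : ∀ v ∈ Ioo s t, ‖y v - y s‖ ≤ r / 4 := fun v hv => by
      rw [← dist_eq_norm]
      linarith [dist_triangle_right (y v) (y s) l, hyb v ⟨hbs.trans hv.1, hv.2⟩, hyb s ⟨hbs, hst⟩]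
    filter_upwards [hC, hC', hloc s t hosc] with n h1 h2 h3
    refine (measureReal_mono (s₂ := Iic s ∪ Ioo s t ∪ {t}) (fun v hv => ?_)
      ((h n).measure_ne_top (t := t) ?_)).trans ((measureReal_union_le _ _).trans (add_le_add
        ((measureReal_union_le _ _).trans (add_le_add h1 h3)) h2))
    · rcases le_or_gt v s with hvs | hvs
      · exact Or.inl (Or.inl hvs)
      · rcases (mem_Iic.mp hv).eq_or_lt with hvt | hvt
        · exact Or.inr hvt
        · exact Or.inl (Or.inr ⟨hvs, hvt⟩)
    · exact union_subset (union_subset (Iic_subset_Iic.mpr hst.le) fun v hv => hv.2.le)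
        (singleton_subset_iff.mpr (mem_Iic.mpr le_rfl))

/-- `norm_sub_sq_le` with the masses bounded uniformly in `n`; `ε ^ 2 / (2 * B)` is the value of `δ`
for which `2 δ B = ε ^ 2`. -/
theorem tendstoUniformlyOn_reflection (hD : IsBoundedConvexC2Domain D)
    (h : ∀ n, ReflectedPath D (yn n) (xn n) (kn n) (νn n)) (h' : ReflectedPath D y x k ν)
    (hy : IsCadlag y) (hlim : ∀ N, TendstoUniformlyOn yn y atTop (Icc 0 N)) (N : ℝ≥0) :
    TendstoUniformlyOn kn k atTop (Icc 0 N) := by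
  obtain ⟨C, hC⟩ := eventually_real_Iic_le hD h hy hlim N
  rw [Metric.tendstoUniformlyOn_iff]
  intro ε hε
  set B : ℝ := |C| + ν.real (Iic N) + 1 with hB
  have hB0 : 0 < B := by positivity
  filter_upwards [hC, Metric.tendstoUniformlyOn_iff.mp (hlim N) (ε ^ 2 / (2 * B)) (by positivity)]
    with n h1 h2 t ht
  have h3 := h'.norm_sub_sq_le hD (h n) (t := t) (δ := ε ^ 2 / (2 * B)) fun s hs => by
    rw [← dist_eq_norm]; exact (h2 s ⟨bot_le, hs.trans ht.2⟩).le
  have h4 : ν.real (Iic t) ≤ ν.real (Iic N) :=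
    measureReal_mono (Iic_subset_Iic.mpr ht.2) (h'.measure_ne_top subset_rfl)
  have h5 : (νn n).real (Iic t) ≤ (νn n).real (Iic N) :=
    measureReal_mono (Iic_subset_Iic.mpr ht.2) ((h n).measure_ne_top subset_rfl)
  have h6 : ν.real (Iic t) + (νn n).real (Iic t) < B := by linarith [le_abs_self C]
  rw [dist_eq_norm]
  refine lt_of_pow_lt_pow_left₀ 2 hε.le (h3.trans_lt ?_)
  calc 2 * (ε ^ 2 / (2 * B)) * (ν.real (Iic t) + (νn n).real (Iic t))
      < 2 * (ε ^ 2 / (2 * B)) * B := by gcongr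
    _ = ε ^ 2 := by field_simp

theorem tendstoUniformlyOn_position (hD : IsBoundedConvexC2Domain D)
    (h : ∀ n, ReflectedPath D (yn n) (xn n) (kn n) (νn n)) (h' : ReflectedPath D y x k ν)
    (hy : IsCadlag y) (hlim : ∀ N, TendstoUniformlyOn yn y atTop (Icc 0 N)) (N : ℝ≥0) :
    TendstoUniformlyOn xn x atTop (Icc 0 N) := by
  have := (hlim N).add (tendstoUniformlyOn_reflection hD h h' hy hlim N)
  have e1 : yn + kn = xn := by ext1 n; ext1 t; exact ((h n).eq_add t).symm
  have e2 : y + k = x := by ext1 t; exact (h'.eq_add t).symm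
  rwa [e1, e2] at this

theorem tendstoUniformlyOn_integral_Iio (hD : IsBoundedConvexC2Domain D)
    (h : ∀ n, ReflectedPath D (yn n) (xn n) (kn n) (νn n)) (h' : ReflectedPath D y x k ν)
    (hy : IsCadlag y) (hlim : ∀ N, TendstoUniformlyOn yn y atTop (Icc 0 N)) (N : ℝ≥0) :
    TendstoUniformlyOn (fun n t => ∫ u in Iio t, inwardNormal D (xn n u) ∂(νn n))
      (fun t => ∫ u in Iio t, inwardNormal D (x u) ∂ν) atTop (Icc 0 N) := by
  rw [Metric.tendstoUniformlyOn_iff]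
  intro ε hε
  filter_upwards [Metric.tendstoUniformlyOn_iff.mp
    (tendstoUniformlyOn_reflection hD h h' hy hlim N) (ε / 2) (by positivity)] with n hn t ht
  rw [dist_eq_norm]
  refine (norm_integral_Iio_sub_le hD h' (h n) (ε := ε / 2) (by positivity) ?_).trans_lt
    (by linarith)
  filter_upwards [self_mem_nhdsWithin] with s hs
  rw [← dist_eq_norm]
  exact (hn s ⟨bot_le, (le_of_lt hs).trans ht.2⟩).le

theorem tendstoUniformlyOn_jump (hD : IsBoundedConvexC2Domain D)
    (h : ∀ n, ReflectedPath D (yn n) (xn n) (kn n) (νn n)) (h' : ReflectedPath D y x k ν)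
    (hy : IsCadlag y) (hlim : ∀ N, TendstoUniformlyOn yn y atTop (Icc 0 N)) (N : ℝ≥0) :
    TendstoUniformlyOn (fun n t => (νn n).real {t} • inwardNormal D (xn n t))
      (fun t => ν.real {t} • inwardNormal D (x t)) atTop (Icc 0 N) := by
  have := (tendstoUniformlyOn_reflection hD h h' hy hlim N).sub
    (tendstoUniformlyOn_integral_Iio hD h h' hy hlim N)
  have e1 : kn - (fun n t => ∫ u in Iio t, inwardNormal D (xn n u) ∂(νn n)) =
      fun n t => (νn n).real {t} • inwardNormal D (xn n t) := by
    ext1 n; ext1 t; exact (h n).sub_integral_Iio hD t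
  have e2 : k - (fun t => ∫ u in Iio t, inwardNormal D (x u) ∂ν) =
      fun t => ν.real {t} • inwardNormal D (x t) := by
    ext1 t; exact h'.sub_integral_Iio hD t
  rwa [e1, e2] at this

end ReflectedPath

/-! ### Convergence of integrals of regulated functions -/

theorem IsRegulated.exists_norm_le {E : Type*} [SeminormedAddCommGroup E] {w : ℝ≥0 → E}
    (hw : IsRegulated w) (t : ℝ≥0) : ∃ C : ℝ, ∀ s ≤ t, ‖w s‖ ≤ C := by
  induction t using NNReal.real_induction with
  | h0 => exact ⟨‖w 0‖, fun s hs => by rw [le_zero_iff.mp hs]⟩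
  | hr t ht =>
    obtain ⟨C, hC⟩ := ht
    obtain ⟨r, hr⟩ := (hw t).2
    obtain ⟨u, hu, hwu⟩ := exists_Ioo_of_eventually_nhdsGT
      (hr.norm.eventually (gt_mem_nhds (lt_add_one ‖r‖)))
    refine ⟨u, hu, fun s hs => ⟨max C (‖r‖ + 1), fun v hv => ?_⟩⟩
    rcases le_or_gt v t with hvt | hvt
    · exact (hC v hvt).trans (le_max_left _ _)
    · exact (hwu v ⟨hvt, hv.trans_lt hs.2⟩).le.trans (le_max_right _ _)
  | hl t ht hlt =>
    obtain ⟨l, hl⟩ := (hw t).1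
    obtain ⟨b, hb, hwb⟩ := exists_Ioo_of_eventually_nhdsLT ht
      (hl.norm.eventually (gt_mem_nhds (lt_add_one ‖l‖)))
    obtain ⟨s, hbs, hst⟩ := exists_between hb
    obtain ⟨C, hC⟩ := hlt s hst
    refine ⟨max (max C (‖l‖ + 1)) ‖w t‖, fun v hv => ?_⟩
    rcases hv.eq_or_lt with rfl | hvt
    · exact le_max_right _ _
    refine le_trans ?_ (le_max_left _ _)
    rcases le_or_gt v s with hvs | hvs
    · exact (hC v hvs).trans (le_max_left _ _)
    · exact (hwb v ⟨hbs.trans hvs, hvt⟩).le.trans (le_max_right _ _)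

namespace ReflectedPath

variable {d : ℕ} {D : Set (EuclideanSpace ℝ (Fin d))}
  {yn xn kn : ℕ → ℝ≥0 → EuclideanSpace ℝ (Fin d)} {νn : ℕ → Measure ℝ≥0}
  {y x k : ℝ≥0 → EuclideanSpace ℝ (Fin d)} {ν : Measure ℝ≥0}

theorem integrableOn_inner (hD : IsBoundedConvexC2Domain D) (h : ReflectedPath D y x k ν)
    {w : ℝ≥0 → EuclideanSpace ℝ (Fin d)} (hw : IsRegulated w) {S : Set ℝ≥0} {t : ℝ≥0}
    (hSm : MeasurableSet S) (hS : S ⊆ Iic t) :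
    IntegrableOn (fun s => inner ℝ (w s) (inwardNormal D (x s))) S ν := by
  have := h.isFiniteMeasure_restrict hS
  obtain ⟨C, hC⟩ := hw.exists_norm_le t
  refine (integrable_const C).mono' (hw.measurable.inner
    ((measurable_inwardNormal hD).comp h.measurable)).aestronglyMeasurable ?_
  filter_upwards [ae_restrict_mem hSm] with s hs
  exact (norm_inner_le_norm _ _).trans ((mul_le_of_le_one_right (norm_nonneg _)
    (norm_inwardNormal_le_one hD _)).trans (hC s (hS hs)))

/-- Freezing `w` at `c` on the open interval turns its integral into `⟨c, k_{t-} - k_s⟩`. Apart from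
the integral up to `s`, the approximating terms involve only quantities already known to converge
with `n`. -/
theorem abs_integral_inner_sub_le (hD : IsBoundedConvexC2Domain D) (h : ReflectedPath D y x k ν)
    {w : ℝ≥0 → EuclideanSpace ℝ (Fin d)} (hw : IsRegulated w) {s t : ℝ≥0} (hst : s < t)
    {c : EuclideanSpace ℝ (Fin d)} {ε : ℝ} (hc : ∀ u ∈ Ioo s t, ‖w u - c‖ ≤ ε) :
    |∫ u in Iic t, inner ℝ (w u) (inwardNormal D (x u)) ∂ν -
      (∫ u in Iic s, inner ℝ (w u) (inwardNormal D (x u)) ∂ν +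
        inner ℝ c ((∫ u in Iio t, inwardNormal D (x u) ∂ν) - k s) +
        inner ℝ (w t) (ν.real {t} • inwardNormal D (x t)))| ≤ ε * ν.real (Ioo s t) := by
  have hsub : Ioo s t ⊆ Iic t := fun u hu => hu.2.le
  have hfin := h.isFiniteMeasure_restrict hsub
  have hset : Iio t = Iic s ∪ Ioo s t := (Iic_union_Ioo_eq_Iio hst).symm
  have hdisj : Disjoint (Iic s) (Ioo s t) :=
    disjoint_left.mpr fun u hu hu' => (not_lt.mpr (mem_Iic.mp hu)) hu'.1
  have hsI : Iic s ⊆ Iic t := Iic_subset_Iic.mpr hst.le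
  have e1 : (∫ u in Iio t, inwardNormal D (x u) ∂ν) - k s =
      ∫ u in Ioo s t, inwardNormal D (x u) ∂ν := by
    rw [hset, setIntegral_union hdisj measurableSet_Ioo (h.integrableOn hD hsI)
      (h.integrableOn hD hsub), h.eq_integral, add_sub_cancel_left]
  have e2 : ∫ u in Iic t, inner ℝ (w u) (inwardNormal D (x u)) ∂ν =
      ∫ u in Iic s, inner ℝ (w u) (inwardNormal D (x u)) ∂ν +
      ∫ u in Ioo s t, inner ℝ (w u) (inwardNormal D (x u)) ∂ν +
      inner ℝ (w t) (ν.real {t} • inwardNormal D (x t)) := by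
    rw [← Iio_union_right, setIntegral_union (by simp) (measurableSet_singleton t)
      (h.integrableOn_inner hD hw measurableSet_Iio Iio_subset_Iic_self)
      (h.integrableOn_inner hD hw (measurableSet_singleton t)
        (singleton_subset_iff.mpr (mem_Iic.mpr le_rfl))), hset,
      setIntegral_union hdisj measurableSet_Ioo
        (h.integrableOn_inner hD hw measurableSet_Iic hsI)
        (h.integrableOn_inner hD hw measurableSet_Ioo hsub), integral_singleton,
      real_inner_smul_right, smul_eq_mul]
  have e3 : ∀ A B C B' : ℝ, A + B + C - (A + B' + C) = B - B' := fun A B C B' => by ring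
  rw [e1, e2, e3, ← integral_inner (h.integrableOn hD hsub),
    ← integral_sub (h.integrableOn_inner hD hw measurableSet_Ioo hsub)
      ((h.integrableOn hD hsub).const_inner c), ← Real.norm_eq_abs]
  refine norm_setIntegral_le_of_norm_le_const (by
    rw [← Measure.restrict_apply_univ]; exact measure_lt_top _ _) fun u hu => ?_
  rw [← inner_sub_left]
  exact (norm_inner_le_norm _ _).trans ((mul_le_of_le_one_right (norm_nonneg _)
    (norm_inwardNormal_le_one hD _)).trans (hc u hu))

theorem tendsto_integral_inner (hD : IsBoundedConvexC2Domain D)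
    (h : ∀ n, ReflectedPath D (yn n) (xn n) (kn n) (νn n)) (h' : ReflectedPath D y x k ν)
    (hy : IsCadlag y) (hlim : ∀ N, TendstoUniformlyOn yn y atTop (Icc 0 N))
    {w : ℝ≥0 → EuclideanSpace ℝ (Fin d)} (hw : IsRegulated w) (t : ℝ≥0) :
    Tendsto (fun n => ∫ u in Iic t, inner ℝ (w u) (inwardNormal D (xn n u)) ∂(νn n)) atTop
      (𝓝 (∫ u in Iic t, inner ℝ (w u) (inwardNormal D (x u)) ∂ν)) := by
  have hk : ∀ t, Tendsto (fun n => kn n t) atTop (𝓝 (k t)) := fun t =>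
    (tendstoUniformlyOn_reflection hD h h' hy hlim t).tendsto_at ⟨bot_le, le_rfl⟩
  have hK : ∀ t, Tendsto (fun n => ∫ u in Iio t, inwardNormal D (xn n u) ∂(νn n)) atTop
      (𝓝 (∫ u in Iio t, inwardNormal D (x u) ∂ν)) := fun t =>
    (tendstoUniformlyOn_integral_Iio hD h h' hy hlim t).tendsto_at ⟨bot_le, le_rfl⟩
  have hJ : ∀ t, Tendsto (fun n => (νn n).real {t} • inwardNormal D (xn n t)) atTop
      (𝓝 (ν.real {t} • inwardNormal D (x t))) := fun t =>
    (tendstoUniformlyOn_jump hD h h' hy hlim t).tendsto_at ⟨bot_le, le_rfl⟩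
  set e : ℕ → ℝ≥0 → ℝ := fun n t =>
    |∫ u in Iic t, inner ℝ (w u) (inwardNormal D (xn n u)) ∂(νn n) -
      ∫ u in Iic t, inner ℝ (w u) (inwardNormal D (x u)) ∂ν| with he
  -- The `ε`-error is charged to mass, which is additive over adjacent intervals and so does not
  -- accumulate with the number of steps; the arbitrary `δ` absorbs the convergence of left limits,
  -- values and jumps.
  have main : ∀ ε : ℝ, 0 < ε → ∀ t : ℝ≥0, ∀ δ : ℝ, 0 < δ → ∀ᶠ n in atTop,
      e n t ≤ ε * ((νn n).real (Iic t) + ν.real (Iic t)) + δ := by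
    intro ε hε
    have step : ∀ (s t : ℝ≥0) (c : EuclideanSpace ℝ (Fin d)), s < t →
        (∀ u ∈ Ioo s t, ‖w u - c‖ ≤ ε) →
        (∀ δ : ℝ, 0 < δ → ∀ᶠ n in atTop,
          e n s ≤ ε * ((νn n).real (Iic s) + ν.real (Iic s)) + δ) →
        ∀ δ : ℝ, 0 < δ → ∀ᶠ n in atTop,
          e n t ≤ ε * ((νn n).real (Iic t) + ν.real (Iic t)) + δ := by
      intro s t c hst hc hs δ hδ
      have hlim2 := ((tendsto_const_nhds (x := c)).inner (𝕜 := ℝ) ((hK t).sub (hk s))).add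
        ((tendsto_const_nhds (x := w t)).inner (𝕜 := ℝ) (hJ t))
      filter_upwards [hs (δ / 2) (by positivity),
        Metric.tendsto_nhds.mp hlim2 (δ / 2) (by positivity)] with n h1 h2
      have h3 := (h n).abs_integral_inner_sub_le hD hw hst hc
      have h4 := h'.abs_integral_inner_sub_le hD hw hst hc
      have hmass : ∀ {y x k : ℝ≥0 → EuclideanSpace ℝ (Fin d)} {ν : Measure ℝ≥0},
          ReflectedPath D y x k ν → ν.real (Iic s) + ν.real (Ioo s t) ≤ ν.real (Iic t) := by
        intro y x k ν h
        have hsub : Ioo s t ⊆ Iic t := fun u hu => hu.2.le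
        rw [← measureReal_union (disjoint_left.mpr fun u hu hu' =>
          (not_lt.mpr (mem_Iic.mp hu)) hu'.1) measurableSet_Ioo
          (h.measure_ne_top (Iic_subset_Iic.mpr hst.le)) (h.measure_ne_top hsub)]
        exact measureReal_mono (union_subset (Iic_subset_Iic.mpr hst.le) hsub)
          (h.measure_ne_top subset_rfl)
      have h5 := mul_le_mul_of_nonneg_left (hmass (h n)) hε.le
      have h6 := mul_le_mul_of_nonneg_left (hmass h') hε.le
      rw [Real.dist_eq] at h2
      simp only [he] at h1 ⊢
      rw [abs_le] at h1 h3 h4 ⊢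
      rw [abs_lt] at h2
      constructor <;> linarith [h1.1, h1.2, h2.1, h2.2, h3.1, h3.2, h4.1, h4.2]
    intro t
    induction t using NNReal.real_induction with
    | h0 =>
      intro δ hδ
      have hz : Iic (0 : ℝ≥0) = {0} := by ext; simp
      filter_upwards [Metric.tendsto_nhds.mp ((tendsto_const_nhds (x := w 0)).inner (𝕜 := ℝ)
        (hJ 0)) δ hδ] with n hn
      rw [Real.dist_eq, real_inner_smul_right, real_inner_smul_right] at hn
      have : e n 0 ≤ δ := by
        simp only [he, hz, integral_singleton, smul_eq_mul]
        exact hn.le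
      have : 0 ≤ ε * ((νn n).real (Iic 0) + ν.real (Iic 0)) := by positivity
      linarith
    | hr t ht =>
      obtain ⟨r, hr⟩ := (hw t).2
      obtain ⟨u, hu, hwu⟩ := exists_Ioo_of_eventually_nhdsGT (Metric.tendsto_nhds.mp hr ε hε)
      refine ⟨u, hu, fun s hs => step t s r hs.1 (fun v hv => ?_) ht⟩
      rw [← dist_eq_norm]
      exact (hwu v ⟨hv.1, hv.2.trans hs.2⟩).le
    | hl t ht hlt =>
      obtain ⟨l, hl⟩ := (hw t).1
      obtain ⟨b, hb, hwb⟩ := exists_Ioo_of_eventually_nhdsLT ht (Metric.tendsto_nhds.mp hl ε hε)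
      obtain ⟨s, hbs, hst⟩ := exists_between hb
      refine step s t l hst (fun v hv => ?_) (hlt s hst)
      rw [← dist_eq_norm]
      exact (hwb v ⟨hbs.trans hv.1, hv.2⟩).le
  obtain ⟨C, hC⟩ := eventually_real_Iic_le hD h hy hlim t
  set B : ℝ := |C| + ν.real (Iic t) + 1 with hB
  have hB0 : 0 < B := by positivity
  rw [Metric.tendsto_nhds]
  intro ε hε
  filter_upwards [hC, main (ε / (2 * B)) (by positivity) t (ε / 4) (by positivity)] with n h1 h2
  rw [Real.dist_eq]
  refine h2.trans_lt ?_
  have h3 : (νn n).real (Iic t) + ν.real (Iic t) ≤ B := by linarith [le_abs_self C]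
  calc ε / (2 * B) * ((νn n).real (Iic t) + ν.real (Iic t)) + ε / 4
      ≤ ε / (2 * B) * B + ε / 4 := by gcongr
    _ = ε / 2 + ε / 4 := by field_simp
    _ < ε := by linarith

/-- On the boundary `1 = ⟨m(x), n(x)⟩`, which turns `H dν` into `⟨H m(x), dk⟩`. Under `νn` the field
`m (x u)` replaces `m (xn n u)`, with uniformly small error since `m` is uniformly continuous on the
closure of `D`. -/
theorem tendsto_setIntegral_Iic (hD : IsBoundedConvexC2Domain D)
    (h : ∀ n, ReflectedPath D (yn n) (xn n) (kn n) (νn n)) (h' : ReflectedPath D y x k ν)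
    (hy : IsCadlag y) (hlim : ∀ N, TendstoUniformlyOn yn y atTop (Icc 0 N))
    (hx : IsRegulated x) {H : ℝ≥0 → ℝ} (hH : IsRegulated H) (t : ℝ≥0) :
    Tendsto (fun n => ∫ u in Iic t, H u ∂(νn n)) atTop (𝓝 (∫ u in Iic t, H u ∂ν)) := by
  obtain ⟨m, hm, hmD⟩ := exists_continuous_eq_inwardNormal hD
  have hw : IsRegulated fun s => H s • m (x s) := by
    intro s
    obtain ⟨⟨l, hl⟩, r, hr⟩ := hx s
    obtain ⟨⟨l', hl'⟩, r', hr'⟩ := hH s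
    exact ⟨⟨_, hl'.smul ((hm.tendsto l).comp hl)⟩, _, hr'.smul ((hm.tendsto r).comp hr)⟩
  have hcpt : IsCompact (closure D) := hD.bounded.isCompact_closure
  have huc := hcpt.uniformContinuousOn_of_continuous hm.continuousOn
  have hxu := tendstoUniformlyOn_position hD h h' hy hlim t
  obtain ⟨B, hB⟩ := hH.exists_norm_le t
  obtain ⟨C, hC⟩ := eventually_real_Iic_le hD h hy hlim t
  have hinner : ∀ p q : EuclideanSpace ℝ (Fin d), p ∈ frontier D → ∀ a : ℝ,
      a - inner ℝ (a • m q) (inwardNormal D p) = a * inner ℝ (m p - m q) (inwardNormal D p) := by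
    intro p q hp a
    rw [hmD p hp, inner_sub_left, real_inner_self_eq_norm_sq, norm_inwardNormal hD hp,
      real_inner_smul_left]
    ring
  have hlimw := tendsto_integral_inner hD h h' hy hlim hw t
  have e : ∫ u in Iic t, inner ℝ (H u • m (x u)) (inwardNormal D (x u)) ∂ν =
      ∫ u in Iic t, H u ∂ν := by
    refine integral_congr_ae ?_
    filter_upwards [ae_restrict_of_ae h'.ae_mem_frontier] with u hu
    have := hinner _ (x u) hu (H u)
    rw [sub_self, inner_zero_left, mul_zero] at this
    linarith
  rw [e] at hlimw
  have hdiff : Tendsto (fun n => ∫ u in Iic t, H u ∂(νn n) -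
      ∫ u in Iic t, inner ℝ (H u • m (x u)) (inwardNormal D (xn n u)) ∂(νn n)) atTop (𝓝 0) := by
    rw [Metric.tendsto_nhds]
    intro ε hε
    set A : ℝ := (|B| + 1) * (|C| + 1) with hA
    have hA0 : 0 < A := by positivity
    obtain ⟨η, hη, hηm⟩ := Metric.uniformContinuousOn_iff.mp huc (ε / (2 * A)) (by positivity)
    filter_upwards [hC, Metric.tendstoUniformlyOn_iff.mp hxu η hη] with n h1 h2
    have hfin := (h n).isFiniteMeasure_restrict (Subset.refl (Iic t))
    have hHi : IntegrableOn H (Iic t) (νn n) := by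
      refine (integrable_const B).mono' hH.measurable.aestronglyMeasurable ?_
      filter_upwards [ae_restrict_mem measurableSet_Iic] with s hs using hB s hs
    rw [dist_zero_right, ← integral_sub hHi ((h n).integrableOn_inner hD hw measurableSet_Iic
      subset_rfl)]
    have hb : ‖∫ u in Iic t, (H u - inner ℝ (H u • m (x u)) (inwardNormal D (xn n u))) ∂(νn n)‖ ≤
        |B| * (ε / (2 * A)) * (νn n).real (Iic t) := by
      refine norm_setIntegral_le_of_norm_le_const_ae ((h n).measure_Iic_lt_top t) ?_
      filter_upwards [ae_restrict_of_ae (h n).ae_mem_frontier, ae_restrict_mem measurableSet_Iic]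
        with u hu hut
      rw [hinner _ _ hu, norm_mul]
      refine mul_le_mul ((hB u hut).trans (le_abs_self B)) ?_ (norm_nonneg _) (abs_nonneg _)
      refine (norm_inner_le_norm _ _).trans ?_
      rw [norm_inwardNormal hD hu, mul_one, ← dist_eq_norm]
      have := h2 u ⟨bot_le, hut⟩
      rw [dist_comm] at this
      exact (hηm _ ((h n).mem_closure u) _ (h'.mem_closure u) this).le
    refine hb.trans_lt ?_
    calc |B| * (ε / (2 * A)) * (νn n).real (Iic t)
        ≤ (|B| + 1) * (ε / (2 * A)) * (|C| + 1) := by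
          gcongr
          · linarith
          · linarith [le_abs_self C]
      _ = ε / 2 := by rw [hA]; field_simp
      _ < ε := by linarith
  simpa using hdiff.add hlimw

/-- The uniform error between `Hn` and `H` is multiplied by a bounded mass. Moving the endpoint
costs at most the `νn`-mass of a small interval around `T`, which tends to its small `ν`-mass
because `T` is not an atom of `ν`. -/
theorem tendsto_setIntegral_Iic_moving (hD : IsBoundedConvexC2Domain D)
    (h : ∀ n, ReflectedPath D (yn n) (xn n) (kn n) (νn n)) (h' : ReflectedPath D y x k ν)
    (hy : IsCadlag y) (hlim : ∀ N, TendstoUniformlyOn yn y atTop (Icc 0 N))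
    (hx : IsRegulated x) {H : ℝ≥0 → ℝ} (hH : IsRegulated H) {Hn : ℕ → ℝ≥0 → ℝ}
    (hHn : ∀ n, Measurable (Hn n)) {T : ℝ≥0} (hT : 0 < T) (hνT : ν {T} = 0) {Tn : ℕ → ℝ≥0}
    (hTn : Tendsto Tn atTop (𝓝 T))
    (hHlim : ∀ ε : ℝ, 0 < ε → ∀ᶠ n in atTop, ∀ s ≤ Tn n, |Hn n s - H s| ≤ ε) :
    Tendsto (fun n => ∫ u in Iic (Tn n), Hn n u ∂(νn n)) atTop (𝓝 (∫ u in Iic T, H u ∂ν)) := by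
  have hmass : ∀ t, Tendsto (fun n => (νn n).real (Iic t)) atTop (𝓝 (ν.real (Iic t))) := by
    intro t
    have h1 : IsRegulated fun _ : ℝ≥0 => (1 : ℝ) := fun s =>
      ⟨⟨1, tendsto_const_nhds⟩, 1, tendsto_const_nhds⟩
    simpa using tendsto_setIntegral_Iic hD h h' hy hlim hx h1 t
  obtain ⟨B, hB⟩ := hH.exists_norm_le (T + 1)
  have hB0 : 0 ≤ B := (norm_nonneg _).trans (hB T (le_add_of_nonneg_right zero_le_one))
  have hHT := tendsto_setIntegral_Iic hD h h' hy hlim hx hH T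
  have hlt : ∀ᶠ n in atTop, Tn n < T + 1 := hTn.eventually (gt_mem_nhds (lt_add_one T))
  have hHi : ∀ n, ∀ t ≤ T + 1, IntegrableOn H (Iic t) (νn n) := by
    intro n t ht
    have hfin := (h n).isFiniteMeasure_restrict (Subset.refl (Iic t))
    refine (integrable_const B).mono' hH.measurable.aestronglyMeasurable ?_
    filter_upwards [ae_restrict_mem measurableSet_Iic] with s hs using hB s (le_trans hs ht)
  have hd1 : Tendsto (fun n => ∫ u in Iic (Tn n), Hn n u ∂(νn n) -
      ∫ u in Iic (Tn n), H u ∂(νn n)) atTop (𝓝 0) := by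
    rw [Metric.tendsto_nhds]
    intro ε hε
    obtain ⟨C, hC⟩ := eventually_real_Iic_le hD h hy hlim (T + 1)
    filter_upwards [hC, hlt, hHlim (ε / (2 * (|C| + 1))) (by positivity)] with n h1 h2 h3
    have hfin := (h n).isFiniteMeasure_restrict (Subset.refl (Iic (Tn n)))
    have hHni : IntegrableOn (Hn n) (Iic (Tn n)) (νn n) := by
      refine (integrable_const (B + ε / (2 * (|C| + 1)))).mono' (hHn n).aestronglyMeasurable ?_
      filter_upwards [ae_restrict_mem measurableSet_Iic] with s hs
      have h4 := h3 s hs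
      have h5 := hB s (le_trans hs h2.le)
      rw [Real.norm_eq_abs] at h5 ⊢
      linarith [abs_sub_abs_le_abs_sub (Hn n s) (H s)]
    rw [dist_zero_right, ← integral_sub hHni (hHi n _ h2.le)]
    refine (norm_setIntegral_le_of_norm_le_const ((h n).measure_Iic_lt_top _)
      (C := ε / (2 * (|C| + 1))) fun s hs => h3 s hs).trans_lt ?_
    have h6 : (νn n).real (Iic (Tn n)) ≤ |C| + 1 := by
      refine (measureReal_mono (Iic_subset_Iic.mpr h2.le)
        ((h n).measure_ne_top subset_rfl)).trans (h1.trans ?_)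
      linarith [le_abs_self C]
    calc ε / (2 * (|C| + 1)) * (νn n).real (Iic (Tn n))
        ≤ ε / (2 * (|C| + 1)) * (|C| + 1) := by gcongr
      _ = ε / 2 := by field_simp
      _ < ε := by linarith
  have hd2 : Tendsto (fun n => ∫ u in Iic (Tn n), H u ∂(νn n) - ∫ u in Iic T, H u ∂(νn n))
      atTop (𝓝 0) := by
    rw [Metric.tendsto_nhds]
    intro ε hε
    have := h'.isLocallyFiniteMeasure
    set η : ℝ := ε / (2 * (B + 1)) with hη
    have hη0 : 0 < η := by positivity
    -- Outer regularity gives a neighbourhood of `T` of `ν`-mass below `η`; `Ioc a b` is then chosen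
    -- inside it.
    obtain ⟨U, hUT, hUo, hU⟩ := ({T} : Set ℝ≥0).exists_isOpen_lt_of_lt (μ := ν)
      (ENNReal.ofReal η) (by rw [hνT]; exact ENNReal.ofReal_pos.mpr hη0)
    have hUn : U ∈ 𝓝 T := hUo.mem_nhds (singleton_subset_iff.mp hUT)
    obtain ⟨a, ha, haU⟩ := exists_Ioc_subset_of_mem_nhds hUn ⟨0, hT⟩
    obtain ⟨b', hb', hbU'⟩ := exists_Ico_subset_of_mem_nhds hUn ⟨T + 1, lt_add_one T⟩
    obtain ⟨b, hTb, hbb⟩ := exists_between (lt_min hb' (lt_add_one T))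
    have hab : Ioc a b ⊆ U := fun u hu => by
      rcases le_or_gt u T with huT | huT
      · exact haU ⟨hu.1, huT⟩
      · exact hbU' ⟨huT.le, hu.2.trans_lt (hbb.trans_le (min_le_left _ _))⟩
    have hIoc : ∀ {y x k : ℝ≥0 → EuclideanSpace ℝ (Fin d)} {ν : Measure ℝ≥0},
        ReflectedPath D y x k ν → ν.real (Ioc a b) = ν.real (Iic b) - ν.real (Iic a) := by
      intro y x k ν h
      rw [← Iic_union_Ioc_eq_Iic (ha.trans hTb).le, measureReal_union
        (Iic_disjoint_Ioc le_rfl) measurableSet_Ioc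
        (h.measure_ne_top (Iic_subset_Iic.mpr (ha.trans hTb).le))
        (h.measure_ne_top Ioc_subset_Iic_self), add_sub_cancel_left]
    have hν : ν.real (Ioc a b) < η := by
      rw [measureReal_def, ← ENNReal.lt_ofReal_iff_toReal_lt
        (h'.measure_ne_top Ioc_subset_Iic_self)]
      exact (measure_mono hab).trans_lt hU
    have hlimIoc : Tendsto (fun n => (νn n).real (Ioc a b)) atTop (𝓝 (ν.real (Ioc a b))) := by
      rw [hIoc h']
      simp_rw [fun n => hIoc (h n)]
      exact (hmass b).sub (hmass a)
    have hbT : b ≤ T + 1 := (hbb.trans_le (min_le_right _ _)).le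
    have hsub : ∀ n, ∀ s t, a ≤ s → s ≤ t → t ≤ b →
        |∫ u in Iic t, H u ∂(νn n) - ∫ u in Iic s, H u ∂(νn n)| ≤ B * (νn n).real (Ioc a b) := by
      intro n s t has hst htb
      have hi := hHi n t (htb.trans hbT)
      rw [← Iic_union_Ioc_eq_Iic hst, setIntegral_union (Iic_disjoint_Ioc le_rfl)
        measurableSet_Ioc (hi.mono_set (Iic_subset_Iic.mpr hst))
        (hi.mono_set Ioc_subset_Iic_self), add_sub_cancel_left, ← Real.norm_eq_abs]
      refine (norm_setIntegral_le_of_norm_le_const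
        ((h n).measure_ne_top Ioc_subset_Iic_self).lt_top
        fun u hu => hB u (hu.2.trans (htb.trans hbT))).trans ?_
      gcongr
      exact (h n).measure_ne_top Ioc_subset_Iic_self
    filter_upwards [hlimIoc.eventually (gt_mem_nhds hν), hTn.eventually (lt_mem_nhds ha),
      hTn.eventually (gt_mem_nhds hTb)] with n h1 h2 h3
    rw [dist_zero_right, Real.norm_eq_abs]
    have h4 : |∫ u in Iic (Tn n), H u ∂(νn n) - ∫ u in Iic T, H u ∂(νn n)| ≤
        B * (νn n).real (Ioc a b) := by
      rcases le_total (Tn n) T with hc | hc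
      · rw [abs_sub_comm]
        exact hsub n _ _ h2.le hc hTb.le
      · exact hsub n _ _ ha.le hc h3.le
    refine h4.trans_lt ?_
    calc B * (νn n).real (Ioc a b) ≤ (B + 1) * η := by gcongr; linarith
      _ = ε / 2 := by rw [hη]; field_simp
      _ < ε := by linarith
  simpa using (hd1.add hd2).add hHT

end ReflectedPath

/-! ### Solutions of the Skorokhod problem are reflected paths -/

namespace IsSkorokhodSolution

variable {d : ℕ} {D : Set (EuclideanSpace ℝ (Fin d))}
  {y x k : ℝ≥0 → EuclideanSpace ℝ (Fin d)}

theorem measurable (h : IsSkorokhodSolution D y x k) : Measurable x :=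
  h.cadlag_x.isRegulated.measurable

theorem measurableSet_frontier (h : IsSkorokhodSolution D y x k) :
    MeasurableSet {s | x s ∈ frontier D} :=
  h.measurable isClosed_frontier.measurableSet

theorem variationMeasure_eq (h : IsSkorokhodSolution D y x k) :
    variationMeasure k =
      (monotone_totalVar h.boundedVariation).stieltjesFunction.measure := by
  rw [variationMeasure, dif_pos h.boundedVariation]

theorem totalVar_eq_real (h : IsSkorokhodSolution D y x k) (t : ℝ≥0) :
    totalVar k t = (variationMeasure k).real ({s | x s ∈ frontier D} ∩ Ioc 0 t) := by
  rw [h.variation_eq, integral_indicator h.measurableSet_frontier,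
    Measure.restrict_restrict h.measurableSet_frontier]
  simp

theorem variationMeasure_Ioc_ne_top (h : IsSkorokhodSolution D y x k) (s t : ℝ≥0) :
    variationMeasure k (Ioc s t) ≠ ∞ := by
  rw [h.variationMeasure_eq, StieltjesFunction.measure_Ioc]
  exact ENNReal.ofReal_ne_top

/-- `d|k|` is built from the right-continuous version `S` of `|k|`. By `variation_eq`, an increment
of `|k|` over `(t, u]` is at most `S u - S t`, which tends to `0`; hence `|k|` is already right
continuous. -/
theorem stieltjesFunction_eq_totalVar (h : IsSkorokhodSolution D y x k) (t : ℝ≥0) :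
    (monotone_totalVar h.boundedVariation).stieltjesFunction t = totalVar k t := by
  set V := monotone_totalVar h.boundedVariation
  set S := V.stieltjesFunction with hS
  have hSt : S t = Function.rightLim (totalVar k) t := V.stieltjesFunction_eq t
  refine le_antisymm ?_ (by rw [hSt]; exact V.le_rightLim le_rfl)
  have h1 : Tendsto (totalVar k) (𝓝[>] t) (𝓝 (S t)) := by
    rw [hSt]; exact V.tendsto_rightLim t
  have h2 : Tendsto (fun u => totalVar k t + (S u - S t)) (𝓝[>] t)
      (𝓝 (totalVar k t + (S t - S t))) :=
    (((S.right_continuous t).tendsto.mono_left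
      (nhdsWithin_mono t Ioi_subset_Ici_self)).sub_const _).const_add _
  rw [sub_self, add_zero] at h2
  refine le_of_tendsto_of_tendsto h1 h2 ?_
  filter_upwards [self_mem_nhdsWithin] with u hu
  have htu : t ≤ u := le_of_lt hu
  have hfin := h.variationMeasure_Ioc_ne_top
  rw [h.totalVar_eq_real u, h.totalVar_eq_real t, ← Ioc_union_Ioc_eq_Ioc (zero_le : 0 ≤ t) htu,
    inter_union_distrib_left]
  refine (measureReal_union_le _ _).trans (add_le_add le_rfl ?_)
  refine (measureReal_mono inter_subset_right (hfin t u)).trans_eq ?_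
  rw [measureReal_def, h.variationMeasure_eq, StieltjesFunction.measure_Ioc,
    ENNReal.toReal_ofReal (sub_nonneg.mpr (S.mono htu))]

/-- The full mass of `(0, t]` is `|k|_t`, and by `variation_eq` the boundary times alone already
account for it. -/
theorem variationMeasure_Ioc_diff (h : IsSkorokhodSolution D y x k) (t : ℝ≥0) :
    variationMeasure k (Ioc 0 t \ {s | x s ∈ frontier D}) = 0 := by
  have hfin := h.variationMeasure_Ioc_ne_top 0 t
  have h1 := measureReal_inter_add_sdiff (μ := variationMeasure k) (s := Ioc 0 t)
    h.measurableSet_frontier hfin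
  have h0 : totalVar k 0 = 0 := by rw [h.totalVar_eq_real]; simp
  have h2 : (variationMeasure k).real (Ioc 0 t) = totalVar k t := by
    rw [measureReal_def, h.variationMeasure_eq, StieltjesFunction.measure_Ioc,
      h.stieltjesFunction_eq_totalVar, h.stieltjesFunction_eq_totalVar, h0, sub_zero,
      ENNReal.toReal_ofReal]
    rw [h.totalVar_eq_real]; exact measureReal_nonneg
  rw [h2, inter_comm, ← h.totalVar_eq_real] at h1
  have h3 : (variationMeasure k).real (Ioc 0 t \ {s | x s ∈ frontier D}) = 0 := by linarith
  exact (measureReal_eq_zero_iff ((measure_mono sdiff_subset).trans_lt hfin.lt_top).ne).mp h3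

theorem variationMeasure_singleton_zero (h : IsSkorokhodSolution D y x k) :
    variationMeasure k {0} = 0 := by
  rw [h.variationMeasure_eq, StieltjesFunction.measure_singleton,
    leftLim_eq_of_eq_bot _ (by simp)]
  simp

theorem ae_variationMeasure_mem_frontier (h : IsSkorokhodSolution D y x k) :
    ∀ᵐ s ∂(variationMeasure k), x s ∈ frontier D := by
  rw [ae_iff]
  refine measure_mono_null (t := {0} ∪ ⋃ n : ℕ, (Ioc 0 (n : ℝ≥0) \ {s | x s ∈ frontier D}))
    (fun s hs => ?_) (measure_union_null h.variationMeasure_singleton_zero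
      (measure_iUnion_null fun n => h.variationMeasure_Ioc_diff n))
  rcases eq_zero_or_pos s with h0 | h0
  · exact Or.inl h0
  · obtain ⟨n, hn⟩ := exists_nat_ge s
    exact Or.inr (mem_iUnion.mpr ⟨n, ⟨h0, hn⟩, hs⟩)

theorem zero_eq (hD : IsBoundedConvexC2Domain D) (h : IsSkorokhodSolution D y x k) :
    k 0 = ‖k 0‖ • inwardNormal D (x 0) ∧ (k 0 ≠ 0 → x 0 ∈ frontier D) := by
  have hx0 : x 0 = metricProj D (y 0) := by rw [h.eq_add, h.k_zero]; abel
  rw [hx0, h.k_zero]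
  exact ⟨metricProj_sub_eq hD (y 0), fun hne =>
    metricProj_mem_frontier hD fun h => hne (sub_eq_zero.mpr h)⟩

/-- The relation `k 0 = ‖k 0‖ • n(x 0)` absorbs the initial value into the integral as the atom at
`0`. -/
theorem reflectedPath (hD : IsBoundedConvexC2Domain D) (h : IsSkorokhodSolution D y x k) :
    ReflectedPath D y x k (normVariationMeasure k) := by
  have hset : ∀ t : ℝ≥0, Iic t = {0} ∪ Ioc 0 t := fun t => by
    ext s
    rcases eq_zero_or_pos s with rfl | hs
    · simp
    · simp
  have hfin : ∀ t, variationMeasure k (Iic t) < ∞ := fun t => by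
    rw [hset]
    refine (measure_union_le _ _).trans_lt ?_
    rw [h.variationMeasure_singleton_zero, zero_add]
    exact (h.variationMeasure_Ioc_ne_top 0 t).lt_top
  refine ⟨h.measurable, h.eq_add, h.mem_closure, fun t => ?_, ?_, fun t => ?_⟩
  · rw [normVariationMeasure, Measure.add_apply, Measure.smul_apply, smul_eq_mul]
    exact ENNReal.add_lt_top.mpr ⟨hfin t, ENNReal.mul_lt_top ENNReal.ofReal_lt_top
      (measure_lt_top _ _)⟩
  · rw [normVariationMeasure, ae_add_measure_iff]
    refine ⟨h.ae_variationMeasure_mem_frontier, ?_⟩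
    by_cases hk : k 0 = 0
    · simp [hk]
    · refine Measure.ae_smul_measure ?_ _
      rw [ae_dirac_iff h.measurableSet_frontier]
      exact (h.zero_eq hD).2 hk
  · have hm : Measurable fun s => inwardNormal D (x s) :=
      (measurable_inwardNormal hD).comp h.measurable
    have hb : ∀ s, ‖inwardNormal D (x s)‖ ≤ 1 := fun s => norm_inwardNormal_le_one hD _
    have : IsFiniteMeasure ((variationMeasure k).restrict (Iic t)) :=
      ⟨by rw [Measure.restrict_apply_univ]; exact hfin t⟩
    have hi : Integrable (fun s => inwardNormal D (x s)) ((variationMeasure k).restrict (Iic t)) :=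
      (integrable_const (1 : ℝ)).mono' hm.aestronglyMeasurable (Eventually.of_forall hb)
    have hfd : IsFiniteMeasure (ENNReal.ofReal ‖k 0‖ • Measure.dirac (0 : ℝ≥0)) :=
      Measure.smul_finite _ ENNReal.ofReal_ne_top
    have hi' : Integrable (fun s => inwardNormal D (x s))
        ((ENNReal.ofReal ‖k 0‖ • Measure.dirac (0 : ℝ≥0)).restrict (Iic t)) :=
      (integrable_const (1 : ℝ)).mono' hm.aestronglyMeasurable (Eventually.of_forall hb)
    rw [normVariationMeasure, Measure.restrict_add, integral_add_measure hi hi',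
      Measure.restrict_smul, restrict_dirac, if_pos (mem_Iic.mpr zero_le),
      integral_smul_measure, integral_dirac, ENNReal.toReal_ofReal (norm_nonneg _),
      ← (h.zero_eq hD).1, h.k_eq t, add_comm]
    congr 1
    refine setIntegral_congr_set ?_
    rw [hset]
    exact (union_ae_eq_right_of_ae_eq_empty
      (ae_eq_empty.mpr h.variationMeasure_singleton_zero)).symm

theorem jump_eq (hD : IsBoundedConvexC2Domain D) (h : IsSkorokhodSolution D y x k) (t : ℝ≥0) :
    jump k t = (normVariationMeasure k).real {t} • inwardNormal D (x t) := by
  have hr := h.reflectedPath hD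
  rw [← hr.sub_integral_Iio hD, jump]
  split_ifs with ht
  · subst ht
    simp
  · have ht : 0 < t := pos_iff_ne_zero.mpr ht
    have : (𝓝[<] t).NeBot := nhdsLT_neBot_of_exists_lt ⟨0, ht⟩
    rw [leftLim_eq_of_tendsto (hr.tendsto_integral_Iio hD t)]

/-- If `t` were an atom and `y` had no jump there, `x_{t-} = x_t - ν{t} n(x_t)` would lie strictly
outside the supporting half-space at `x_t`, yet it is a limit of points of the closure. -/
theorem measure_singleton_eq_zero (hD : IsBoundedConvexC2Domain D)
    (h : IsSkorokhodSolution D y x k) {t : ℝ≥0} (ht : 0 < t) (hy : jump y t = 0)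
    (hyc : IsCadlag y) : normVariationMeasure k {t} = 0 := by
  have hr := h.reflectedPath hD
  by_contra hne
  have hxt : x t ∈ frontier D := by
    by_contra hcon
    exact hne (measure_mono_null (singleton_subset_iff.mpr hcon) (ae_iff.mp hr.ae_mem_frontier))
  have hpos : 0 < (normVariationMeasure k).real {t} :=
    ENNReal.toReal_pos hne (hr.measure_ne_top (singleton_subset_iff.mpr (mem_Iic.mpr le_rfl)))
  have : (𝓝[<] t).NeBot := nhdsLT_neBot_of_exists_lt ⟨0, ht⟩
  obtain ⟨l, hl⟩ := (hyc t).2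
  have hyt : y t = l := by
    rw [jump, if_neg ht.ne', leftLim_eq_of_tendsto hl] at hy
    exact sub_eq_zero.mp hy
  have hlimx := hl.add (hr.tendsto_integral_Iio hD t)
  have hmem : l + ∫ u in Iio t, inwardNormal D (x u) ∂(normVariationMeasure k) ∈ closure D :=
    isClosed_closure.mem_of_tendsto hlimx
      (Eventually.of_forall fun s => by
        rw [← h.eq_add]; exact h.mem_closure s)
  have h1 := inner_inwardNormal_nonneg hD (x t) hmem
  have h2 := hr.sub_integral_Iio hD t
  rw [show l + ∫ u in Iio t, inwardNormal D (x u) ∂(normVariationMeasure k) - x t =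
    -(k t - ∫ u in Iio t, inwardNormal D (x u) ∂(normVariationMeasure k)) by
      rw [h.eq_add t, hyt]; abel, h2, inner_neg_left, real_inner_smul_left,
    real_inner_self_eq_norm_sq, norm_inwardNormal hD hxt] at h1
  linarith

end IsSkorokhodSolution

/-! ### The functional as a single integral -/

/-- The average of `g s` over the segment from `x` to `x - v`. -/
noncomputable def jumpAverage {d : ℕ} (g : ℝ≥0 → EuclideanSpace ℝ (Fin d) → ℝ) (s : ℝ≥0)
    (x v : EuclideanSpace ℝ (Fin d)) : ℝ :=
  ∫ θ in (0 : ℝ)..1, g s (x - θ • v)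

section JumpAverage

variable {d : ℕ} {g : ℝ≥0 → EuclideanSpace ℝ (Fin d) → ℝ}

theorem continuous_jumpAverage (hg : Continuous (Function.uncurry g)) :
    Continuous fun p : ℝ≥0 × EuclideanSpace ℝ (Fin d) × EuclideanSpace ℝ (Fin d) =>
      jumpAverage g p.1 p.2.1 p.2.2 := by
  unfold jumpAverage
  refine intervalIntegral.continuous_parametric_intervalIntegral_of_continuous
    (f := fun (p : ℝ≥0 × EuclideanSpace ℝ (Fin d) × EuclideanSpace ℝ (Fin d)) (θ : ℝ) =>
      g p.1 (p.2.1 - θ • p.2.2)) ?_ continuous_const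
  exact hg.comp (f := fun q : (ℝ≥0 × EuclideanSpace ℝ (Fin d) × EuclideanSpace ℝ (Fin d)) × ℝ =>
    (q.1.1, q.1.2.1 - q.2 • q.1.2.2)) (by fun_prop)

theorem jumpAverage_zero (s : ℝ≥0) (x : EuclideanSpace ℝ (Fin d)) :
    jumpAverage g s x 0 = g s x := by
  simp [jumpAverage]

theorem intervalIntegrable_segment (hg : Continuous (Function.uncurry g)) (s : ℝ≥0)
    (x v : EuclideanSpace ℝ (Fin d)) (a b : ℝ) :
    IntervalIntegrable (fun θ : ℝ => g s (x - θ • v)) volume a b :=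
  (hg.comp (f := fun θ : ℝ => (s, x - θ • v)) (by fun_prop)).intervalIntegrable a b

theorem abs_jumpAverage_sub_le {g' : ℝ≥0 → EuclideanSpace ℝ (Fin d) → ℝ}
    (hg : Continuous (Function.uncurry g)) (hg' : Continuous (Function.uncurry g')) {s : ℝ≥0}
    {x v : EuclideanSpace ℝ (Fin d)} {ε : ℝ}
    (h : ∀ θ ∈ Icc (0 : ℝ) 1, |g s (x - θ • v) - g' s (x - θ • v)| ≤ ε) :
    |jumpAverage g s x v - jumpAverage g' s x v| ≤ ε := by
  rw [jumpAverage, jumpAverage, ← intervalIntegral.integral_sub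
    (intervalIntegrable_segment hg s x v 0 1) (intervalIntegrable_segment hg' s x v 0 1),
    ← Real.norm_eq_abs]
  refine (intervalIntegral.norm_integral_le_of_norm_le_const (C := ε) fun θ hθ => ?_).trans_eq
    (by simp)
  rw [uIoc_of_le zero_le_one] at hθ
  exact h θ ⟨hθ.1.le, hθ.2⟩

end JumpAverage

namespace ReflectedPath

variable {d : ℕ} {D : Set (EuclideanSpace ℝ (Fin d))}
  {y x k : ℝ≥0 → EuclideanSpace ℝ (Fin d)} {ν : Measure ℝ≥0}
  {g : ℝ≥0 → EuclideanSpace ℝ (Fin d) → ℝ}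

theorem norm_jump_le_of_Ioo (hD : IsBoundedConvexC2Domain D) (h : ReflectedPath D y x k ν)
    {a b : ℝ≥0} {c : EuclideanSpace ℝ (Fin d)} {ε : ℝ} (hc : ∀ s ∈ Ioo a b, ‖k s - c‖ ≤ ε) :
    ∀ s ∈ Ioo a b, ‖ν.real {s} • inwardNormal D (x s)‖ ≤ 2 * ε := by
  intro s hs
  have : (𝓝[<] s).NeBot := nhdsLT_neBot_of_exists_lt ⟨a, hs.1⟩
  have h1 : ‖∫ u in Iio s, inwardNormal D (x u) ∂ν - c‖ ≤ ε := by
    refine le_of_tendsto ((h.tendsto_integral_Iio hD s).sub_const c).norm ?_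
    filter_upwards [Ioo_mem_nhdsLT hs.1] with u hu
    exact hc u ⟨hu.1, hu.2.trans hs.2⟩
  rw [← h.sub_integral_Iio hD]
  have h2 := hc s hs
  rw [← dist_eq_norm] at h1 h2 ⊢
  linarith [dist_triangle_right (k s) (∫ u in Iio s, inwardNormal D (x u) ∂ν) c]

theorem tendsto_jump_nhdsLT (hD : IsBoundedConvexC2Domain D) (h : ReflectedPath D y x k ν)
    (hk : IsRegulated k) (t : ℝ≥0) :
    Tendsto (fun s => ν.real {s} • inwardNormal D (x s)) (𝓝[<] t) (𝓝 0) := by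
  rcases eq_zero_or_pos t with rfl | ht
  · simp
  obtain ⟨l, hl⟩ := (hk t).1
  rw [Metric.tendsto_nhds]
  intro ε hε
  obtain ⟨a, ha, hka⟩ := exists_Ioo_of_eventually_nhdsLT ht
    (Metric.tendsto_nhds.mp hl (ε / 4) (by positivity))
  filter_upwards [Ioo_mem_nhdsLT ha] with s hs
  rw [dist_zero_right]
  refine (h.norm_jump_le_of_Ioo hD (c := l) (ε := ε / 4) (fun u hu => ?_) s hs).trans_lt
    (by linarith)
  rw [← dist_eq_norm]
  exact (hka u hu).le

theorem tendsto_jump_nhdsGT (hD : IsBoundedConvexC2Domain D) (h : ReflectedPath D y x k ν)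
    (hk : IsRegulated k) (t : ℝ≥0) :
    Tendsto (fun s => ν.real {s} • inwardNormal D (x s)) (𝓝[>] t) (𝓝 0) := by
  obtain ⟨r, hr⟩ := (hk t).2
  rw [Metric.tendsto_nhds]
  intro ε hε
  obtain ⟨b, hb, hkb⟩ := exists_Ioo_of_eventually_nhdsGT
    (Metric.tendsto_nhds.mp hr (ε / 4) (by positivity))
  filter_upwards [Ioo_mem_nhdsGT hb] with s hs
  rw [dist_zero_right]
  refine (h.norm_jump_le_of_Ioo hD (c := r) (ε := ε / 4) (fun u hu => ?_) s hs).trans_lt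
    (by linarith)
  rw [← dist_eq_norm]
  exact (hkb u hu).le

theorem isRegulated_jump (hD : IsBoundedConvexC2Domain D) (h : ReflectedPath D y x k ν)
    (hk : IsRegulated k) : IsRegulated fun s => ν.real {s} • inwardNormal D (x s) := fun t =>
  ⟨⟨0, h.tendsto_jump_nhdsLT hD hk t⟩, 0, h.tendsto_jump_nhdsGT hD hk t⟩

theorem isRegulated_jumpAverage (hD : IsBoundedConvexC2Domain D) (h : ReflectedPath D y x k ν)
    (hx : IsRegulated x) (hk : IsRegulated k) (hg : Continuous (Function.uncurry g)) :
    IsRegulated fun s => jumpAverage g s (x s) (ν.real {s} • inwardNormal D (x s)) := by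
  intro t
  obtain ⟨⟨l, hl⟩, r, hr⟩ := hx t
  have hid : ∀ S : Set ℝ≥0, Tendsto (fun s : ℝ≥0 => s) (𝓝[S] t) (𝓝 t) := fun S =>
    tendsto_id.mono_left nhdsWithin_le_nhds
  exact ⟨⟨_, ((continuous_jumpAverage hg).tendsto (t, l, 0)).comp
      ((hid _).prodMk_nhds (hl.prodMk_nhds (h.tendsto_jump_nhdsLT hD hk t)))⟩,
    _, ((continuous_jumpAverage hg).tendsto (t, r, 0)).comp
      ((hid _).prodMk_nhds (hr.prodMk_nhds (h.tendsto_jump_nhdsGT hD hk t)))⟩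

end ReflectedPath

/-- An s-finite measure has only countably many atoms, and the integrand vanishes elsewhere. -/
theorem setIntegral_eq_tsum_of_eq_zero_off_atoms {ν : Measure ℝ≥0} [SFinite ν] {S : Set ℝ≥0}
    (hS : MeasurableSet S) {F : ℝ≥0 → ℝ} (hF : IntegrableOn F S ν)
    (h0 : ∀ s, ν {s} = 0 → F s = 0) :
    ∫ s in S, F s ∂ν = ∑' s : S, ν.real {(s : ℝ≥0)} * F s := by
  set A : Set ℝ≥0 := {s | 0 < ν {s}} with hA
  have hAc : A.Countable := Measure.countable_meas_pos_of_disjoint_iUnion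
    (fun s => measurableSet_singleton s) fun s t hst => disjoint_singleton.mpr hst
  have hz : ∀ s, s ∉ A → F s = 0 := fun s hs => h0 s (nonpos_iff_eq_zero.mp (not_lt.mp hs))
  rw [setIntegral_eq_of_subset_of_forall_sdiff_eq_zero (s := S ∩ A) (t := S) hS inter_subset_left
      fun s hs => hz s fun hsA => hs.2 ⟨hs.1, hsA⟩,
    setIntegral_countable F (hAc.mono inter_subset_right) (hF.mono_set inter_subset_left)]
  simp only [smul_eq_mul]
  rw [tsum_subtype (S ∩ A) fun s => ν.real {s} * F s, tsum_subtype S fun s => ν.real {s} * F s]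
  congr 1
  ext s
  by_cases hs : s ∈ S <;> by_cases hsA : s ∈ A <;> simp [indicator, hs, hsA, hz]

/-- At an atom `x s` is on the boundary, so the projection in `gBar` returns `x s`; then rescale `r
= θ |Δk_s|`. Away from atoms both sides vanish. -/
theorem IsSkorokhodSolution.integral_gBar_eq {d : ℕ} {D : Set (EuclideanSpace ℝ (Fin d))}
    {y x k : ℝ≥0 → EuclideanSpace ℝ (Fin d)} {g : ℝ≥0 → EuclideanSpace ℝ (Fin d) → ℝ}
    (hD : IsBoundedConvexC2Domain D) (h : IsSkorokhodSolution D y x k)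
    (hg : Continuous (Function.uncurry g)) (s : ℝ≥0) :
    ∫ r in (0 : ℝ)..‖jump k s‖, gBar D g s (x s - r • inwardNormal D (x s)) =
      (normVariationMeasure k).real {s} * (jumpAverage g s (x s)
        ((normVariationMeasure k).real {s} • inwardNormal D (x s)) - g s (x s)) := by
  have hr := h.reflectedPath hD
  rw [h.jump_eq hD, hr.norm_real_smul_inwardNormal hD]
  set m := (normVariationMeasure k).real {s} with hm
  by_cases hm0 : m = 0
  · simp [hm0]
  have hmp : 0 < m := lt_of_le_of_ne measureReal_nonneg (Ne.symm hm0)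
  have hxs : x s ∈ frontier D := by
    by_contra hcon
    refine hm0 ?_
    rw [hm, measureReal_def, measure_mono_null (singleton_subset_iff.mpr hcon)
      (ae_iff.mp hr.ae_mem_frontier), ENNReal.toReal_zero]
  have e1 : ∫ r in (0 : ℝ)..m, gBar D g s (x s - r • inwardNormal D (x s)) =
      ∫ r in (0 : ℝ)..m, (g s (x s - r • inwardNormal D (x s)) - g s (x s)) := by
    refine intervalIntegral.integral_congr fun r hr => ?_
    rw [uIcc_of_le hmp.le] at hr
    simp only [gBar]
    rw [metricProj_sub_smul_inwardNormal hD hxs hr.1]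
  have e2 := intervalIntegral.mul_integral_comp_mul_right (a := 0) (b := 1)
    (f := fun r : ℝ => g s (x s - r • inwardNormal D (x s)) - g s (x s)) m
  rw [zero_mul, one_mul] at e2
  rw [e1, ← e2, jumpAverage]
  simp_rw [mul_smul]
  rw [intervalIntegral.integral_sub (intervalIntegrable_segment hg _ _ _ _ _)
    intervalIntegrable_const]
  simp

/-- The jump sum is the `ν`-integral of the average minus `g s (x s)`, a function vanishing off the
atoms, so adding `∫ g dν` leaves only the average. -/
theorem IsSkorokhodSolution.functionalI_eq {d : ℕ} {D : Set (EuclideanSpace ℝ (Fin d))}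
    {y x k : ℝ≥0 → EuclideanSpace ℝ (Fin d)} {g : ℝ≥0 → EuclideanSpace ℝ (Fin d) → ℝ}
    (hD : IsBoundedConvexC2Domain D) (h : IsSkorokhodSolution D y x k)
    (hg : Continuous (Function.uncurry g)) (T : ℝ≥0) :
    functionalI D T g x k = ∫ s in Iic T, jumpAverage g s (x s)
      ((normVariationMeasure k).real {s} • inwardNormal D (x s)) ∂(normVariationMeasure k) := by
  have hr := h.reflectedPath hD
  have hlf := hr.isLocallyFiniteMeasure
  have hfin := hr.isFiniteMeasure_restrict (Subset.refl (Iic T))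
  have hH := hr.isRegulated_jumpAverage hD h.cadlag_x.isRegulated h.cadlag_k.isRegulated hg
  have hG : IsRegulated fun s => g s (x s) := by
    intro t
    obtain ⟨⟨l, hl⟩, r, hr⟩ := h.cadlag_x.isRegulated t
    have hid : ∀ S : Set ℝ≥0, Tendsto (fun s : ℝ≥0 => s) (𝓝[S] t) (𝓝 t) := fun S =>
      tendsto_id.mono_left nhdsWithin_le_nhds
    exact ⟨⟨_, (hg.tendsto (t, l)).comp ((hid _).prodMk_nhds hl)⟩,
      _, (hg.tendsto (t, r)).comp ((hid _).prodMk_nhds hr)⟩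
  have hint : ∀ {w : ℝ≥0 → ℝ}, IsRegulated w →
      IntegrableOn w (Iic T) (normVariationMeasure k) := by
    intro w hw
    obtain ⟨C, hC⟩ := hw.exists_norm_le T
    refine (integrable_const C).mono' hw.measurable.aestronglyMeasurable ?_
    filter_upwards [ae_restrict_mem measurableSet_Iic] with s hs using hC s hs
  have hIcc : Icc 0 T = Iic T := Icc_bot
  rw [functionalI]
  simp_rw [h.integral_gBar_eq hD hg]
  rw [hIcc, ← setIntegral_eq_tsum_of_eq_zero_off_atoms measurableSet_Iic
    (F := fun s => jumpAverage g s (x s)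
      ((normVariationMeasure k).real {s} • inwardNormal D (x s)) - g s (x s))
    ((hint hH).sub (hint hG)) (fun s hs => ?_), integral_sub (hint hH) (hint hG),
    add_sub_cancel]
  simp [measureReal_def, hs, jumpAverage_zero]

/-! ### Convergence of the functionals -/

theorem tendsto_orderIso_symm {lam : ℕ → (ℝ≥0 ≃o ℝ≥0)}
    (hlam : TendstoUniformly (fun n t => lam n t) (fun t => t) atTop) (t : ℝ≥0) :
    Tendsto (fun n => (lam n).symm t) atTop (𝓝 t) := by
  rw [Metric.tendsto_nhds]
  intro ε hε
  filter_upwards [Metric.tendstoUniformly_iff.mp hlam ε hε] with n hn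
  simpa using hn ((lam n).symm t)

/-- Evaluate `xn n ∘ lam n` at `(lam n).symm t`, which tends to `t`, and use continuity of `x`
there. -/
theorem tendsto_of_tendstoUniformlyOn_comp_orderIso {E : Type*} [UniformSpace E]
    {lam : ℕ → (ℝ≥0 ≃o ℝ≥0)}
    (hlam : TendstoUniformly (fun n t => lam n t) (fun t => t) atTop)
    {xn : ℕ → ℝ≥0 → E} {x : ℝ≥0 → E}
    (hx : ∀ N, TendstoUniformlyOn (fun n => xn n ∘ lam n) x atTop (Icc 0 N)) {t : ℝ≥0}
    (ht : ContinuousAt x t) : Tendsto (fun n => xn n t) atTop (𝓝 (x t)) := by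
  have hlim := tendsto_orderIso_symm hlam t
  have h1 : ∀ᶠ n in atTop, (lam n).symm t ∈ Icc 0 (t + 1) := by
    filter_upwards [hlim.eventually (gt_mem_nhds (lt_add_one t))] with n hn
    exact ⟨bot_le, hn.le⟩
  have := (hx (t + 1)).tendsto_comp ht.continuousWithinAt (tendsto_nhdsWithin_iff.mpr ⟨hlim, h1⟩)
  simpa using this

theorem tendsto_intervalIntegral_comp_toNNReal {E : Type*} [PseudoMetricSpace E]
    [MeasurableSpace E] [BorelSpace E] [SecondCountableTopology E] {K : Set E} (hK : IsCompact K)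
    {xn : ℕ → ℝ≥0 → E} {x : ℝ≥0 → E} (hxn : ∀ n, Measurable (xn n)) (hxr : IsRegulated x)
    (hxnK : ∀ n t, xn n t ∈ K)
    (hx : ∀ t, ContinuousAt x t → Tendsto (fun n => xn n t) atTop (𝓝 (x t))) {T : ℝ≥0}
    {fn : ℕ → ℝ≥0 → E → ℝ} {f : ℝ≥0 → E → ℝ}
    (hfn : ∀ n, Continuous (Function.uncurry (fn n))) (hf : Continuous (Function.uncurry f))
    (hlim : TendstoUniformlyOn (fun n => Function.uncurry (fn n)) (Function.uncurry f) atTop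
      (Icc 0 T ×ˢ K)) :
    Tendsto (fun n => ∫ s in (0 : ℝ)..T, fn n s.toNNReal (xn n s.toNNReal)) atTop
      (𝓝 (∫ s in (0 : ℝ)..T, f s.toNNReal (x s.toNNReal))) := by
  obtain ⟨C, hC⟩ := (isCompact_Icc.prod hK).exists_bound_of_continuousOn hf.continuousOn
  have hmem : ∀ s ∈ uIoc (0 : ℝ) T, s.toNNReal ∈ Icc 0 T := fun s hs => by
    rw [uIoc_of_le T.coe_nonneg] at hs
    exact ⟨bot_le, Real.toNNReal_le_iff_le_coe.mpr hs.2⟩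
  refine intervalIntegral.tendsto_integral_filter_of_dominated_convergence (fun _ => C + 1)
    (Eventually.of_forall fun n => ?_) ?_ intervalIntegrable_const ?_
  · exact ((hfn n).measurable.comp (measurable_real_toNNReal.prodMk
      ((hxn n).comp measurable_real_toNNReal))).aestronglyMeasurable
  · filter_upwards [Metric.tendstoUniformlyOn_iff.mp hlim 1 one_pos] with n hn
    refine Eventually.of_forall fun s hs => ?_
    have hp : (s.toNNReal, xn n s.toNNReal) ∈ Icc 0 T ×ˢ K := ⟨hmem s hs, hxnK n _⟩
    have h1 := hn _ hp
    have h2 := hC _ hp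
    rw [dist_comm, dist_eq_norm] at h1
    simp only [Function.uncurry] at h1 h2
    linarith [norm_sub_norm_le (fn n s.toNNReal (xn n s.toNNReal))
      (f s.toNNReal (xn n s.toNNReal))]
  · have hc : ((fun t : ℝ≥0 => (t : ℝ)) '' {t | ¬ ContinuousAt x t}).Countable :=
      hxr.countable_not_continuousAt.image _
    filter_upwards [hc.ae_notMem volume] with s hs hsT
    have hs0 : 0 ≤ s := by
      rw [uIoc_of_le T.coe_nonneg] at hsT
      exact hsT.1.le
    have hcont : ContinuousAt x s.toNNReal := by
      by_contra hcon
      exact hs ⟨_, hcon, Real.coe_toNNReal s hs0⟩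
    exact hlim.tendsto_comp (x := (s.toNNReal, x s.toNNReal))
      (g := fun n => (s.toNNReal, xn n s.toNNReal)) hf.continuousWithinAt
      (tendsto_nhdsWithin_iff.mpr ⟨tendsto_const_nhds.prodMk_nhds (hx _ hcont),
        Eventually.of_forall fun n => ⟨hmem s hsT, hxnK n _⟩⟩)

theorem map_symm_real_singleton (ν : Measure ℝ≥0) (e : ℝ≥0 ≃o ℝ≥0) (s : ℝ≥0) :
    (ν.map e.symm).real {s} = ν.real {e s} := by
  have hemb : MeasurableEmbedding e.symm := e.symm.toHomeomorph.measurableEmbedding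
  rw [measureReal_def, measureReal_def, hemb.map_apply]
  congr 2
  ext u
  simp [OrderIso.symm_apply_eq]

theorem setIntegral_Iic_map_symm (ν : Measure ℝ≥0) (e : ℝ≥0 ≃o ℝ≥0) (F : ℝ≥0 → ℝ) (T : ℝ≥0) :
    ∫ s in Iic (e.symm T), F (e s) ∂(ν.map e.symm) = ∫ s in Iic T, F s ∂ν := by
  have hemb : MeasurableEmbedding e.symm := e.symm.toHomeomorph.measurableEmbedding
  have : e.symm ⁻¹' Iic (e.symm T) = Iic T := by ext; simp
  rw [hemb.setIntegral_map, this]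
  simp

/-- Replace `gn` by `g` on a ball containing all the segments, then use uniform continuity of the
average of `g` on a compact set. Convergence of `gn` is known only up to time `T`; `s ≤ (lam n).symm
T` ensures `lam n s ≤ T`. -/
theorem eventually_abs_jumpAverage_sub_le {d : ℕ} {gn : ℕ → ℝ≥0 → EuclideanSpace ℝ (Fin d) → ℝ}
    {g : ℝ≥0 → EuclideanSpace ℝ (Fin d) → ℝ} (hgn : ∀ n, Continuous (Function.uncurry (gn n)))
    (hg : Continuous (Function.uncurry g)) {T : ℝ≥0}
    (hlim : ∀ K : Set (EuclideanSpace ℝ (Fin d)), IsCompact K →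
      TendstoUniformlyOn (fun n => Function.uncurry (gn n)) (Function.uncurry g) atTop
        (Icc 0 T ×ˢ K))
    {lam : ℕ → (ℝ≥0 ≃o ℝ≥0)}
    (hlam : TendstoUniformly (fun n t => lam n t) (fun t => t) atTop)
    {xn vn : ℕ → ℝ≥0 → EuclideanSpace ℝ (Fin d)} {x v : ℝ≥0 → EuclideanSpace ℝ (Fin d)}
    (hxr : IsRegulated x) (hvr : IsRegulated v)
    (hx : TendstoUniformlyOn xn x atTop (Icc 0 (T + 1)))
    (hv : TendstoUniformlyOn vn v atTop (Icc 0 (T + 1))) {ε : ℝ} (hε : 0 < ε) :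
    ∀ᶠ n in atTop, ∀ s ≤ (lam n).symm T,
      |jumpAverage (gn n) (lam n s) (xn n s) (vn n s) - jumpAverage g s (x s) (v s)| ≤ ε := by
  obtain ⟨A, hA⟩ := hxr.exists_norm_le (T + 1)
  obtain ⟨B, hB⟩ := hvr.exists_norm_le (T + 1)
  set Q : Set (ℝ≥0 × EuclideanSpace ℝ (Fin d) × EuclideanSpace ℝ (Fin d)) :=
    Icc 0 (T + 1) ×ˢ (Metric.closedBall 0 (A + 1) ×ˢ Metric.closedBall 0 (B + 1)) with hQ
  have hQc : IsCompact Q :=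
    isCompact_Icc.prod ((isCompact_closedBall _ _).prod (isCompact_closedBall _ _))
  obtain ⟨η, hη, hηQ⟩ := Metric.uniformContinuousOn_iff.mp
    (hQc.uniformContinuousOn_of_continuous (continuous_jumpAverage hg).continuousOn)
    (ε / 2) (by positivity)
  have hη1 : 0 < min η 1 := lt_min hη one_pos
  filter_upwards [Metric.tendstoUniformlyOn_iff.mp hx _ hη1,
    Metric.tendstoUniformlyOn_iff.mp hv _ hη1, Metric.tendstoUniformly_iff.mp hlam η hη,
    Metric.tendstoUniformlyOn_iff.mp (hlim (Metric.closedBall 0 ((A + 1) + (B + 1)))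
      (isCompact_closedBall _ _)) (ε / 2) (by positivity),
    (tendsto_orderIso_symm hlam T).eventually (gt_mem_nhds (lt_add_one T))]
    with n h1 h2 h3 h4 h5 s hs
  have hsT : s ≤ T + 1 := hs.trans h5.le
  have hlT : lam n s ≤ T := (lam n).le_symm_apply.mp hs
  have hx1 := h1 s ⟨bot_le, hsT⟩
  have hv1 := h2 s ⟨bot_le, hsT⟩
  have hxn : ‖xn n s‖ ≤ A + 1 := by
    rw [dist_comm, dist_eq_norm] at hx1
    linarith [norm_sub_norm_le (xn n s) (x s), hA s hsT, min_le_right η 1]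
  have hvn : ‖vn n s‖ ≤ B + 1 := by
    rw [dist_comm, dist_eq_norm] at hv1
    linarith [norm_sub_norm_le (vn n s) (v s), hB s hsT, min_le_right η 1]
  have e1 : |jumpAverage (gn n) (lam n s) (xn n s) (vn n s) -
      jumpAverage g (lam n s) (xn n s) (vn n s)| ≤ ε / 2 := by
    refine abs_jumpAverage_sub_le (hgn n) hg fun θ hθ => ?_
    have hmem : xn n s - θ • vn n s ∈
        Metric.closedBall (0 : EuclideanSpace ℝ (Fin d)) ((A + 1) + (B + 1)) := by
      rw [mem_closedBall_zero_iff]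
      refine (norm_sub_le _ _).trans (add_le_add hxn ?_)
      rw [norm_smul, Real.norm_of_nonneg hθ.1]
      exact (mul_le_of_le_one_left (norm_nonneg _) hθ.2).trans hvn
    have := h4 (lam n s, xn n s - θ • vn n s) ⟨⟨bot_le, hlT⟩, hmem⟩
    rw [dist_comm, Real.dist_eq] at this
    exact this.le
  have e2 := hηQ (lam n s, xn n s, vn n s)
    ⟨⟨bot_le, hlT.trans (le_add_of_nonneg_right zero_le_one)⟩, by simpa using hxn,
      by simpa using hvn⟩ (s, x s, v s)
    ⟨⟨bot_le, hsT⟩, by simpa using (hA s hsT).trans (by linarith),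
      by simpa using (hB s hsT).trans (by linarith)⟩ (by
      rw [dist_comm, Prod.dist_eq, Prod.dist_eq]
      exact max_lt (h3 s) (max_lt (hx1.trans_le (min_le_left _ _))
        (hv1.trans_le (min_le_left _ _))))
  rw [Real.dist_eq] at e2
  linarith [abs_sub_le (jumpAverage (gn n) (lam n s) (xn n s) (vn n s))
    (jumpAverage g (lam n s) (xn n s) (vn n s)) (jumpAverage g s (x s) (v s))]

theorem theorem2p5 {d : ℕ} (D : Set (EuclideanSpace ℝ (Fin d))) (hD : IsBoundedConvexC2Domain D)
    (yn : ℕ → ℝ≥0 → EuclideanSpace ℝ (Fin d)) (y : ℝ≥0 → EuclideanSpace ℝ (Fin d))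
    (hyn : ∀ n, IsCadlag (yn n)) (hy : IsCadlag y) (hJ1 : TendstoJ1 yn y)
    (xn kn : ℕ → ℝ≥0 → EuclideanSpace ℝ (Fin d)) (x k : ℝ≥0 → EuclideanSpace ℝ (Fin d))
    (hxkn : ∀ n, IsSkorokhodSolution D (yn n) (xn n) (kn n)) (hxk : IsSkorokhodSolution D y x k)
    (T : ℝ≥0) (hT : 0 < T) (hyT : jump y T = 0)
    (fn gn : ℕ → ℝ≥0 → EuclideanSpace ℝ (Fin d) → ℝ) (f g : ℝ≥0 → EuclideanSpace ℝ (Fin d) → ℝ)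
    (hfn : ∀ n, Continuous (Function.uncurry (fn n))) (hf : Continuous (Function.uncurry f))
    (hgn : ∀ n, Continuous (Function.uncurry (gn n))) (hg : Continuous (Function.uncurry g))
    (hfn_lim : TendstoUniformlyOn (fun n => Function.uncurry (fn n)) (Function.uncurry f) atTop
      (Icc 0 T ×ˢ closure D))
    (hgn_lim : ∀ K : Set (EuclideanSpace ℝ (Fin d)), IsCompact K →
      TendstoUniformlyOn (fun n => Function.uncurry (gn n)) (Function.uncurry g) atTop
        (Icc 0 T ×ˢ K)) :
    Tendsto (fun n => ∫ s in (0 : ℝ)..T, fn n s.toNNReal (xn n s.toNNReal)) atTop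
      (𝓝 (∫ s in (0 : ℝ)..T, f s.toNNReal (x s.toNNReal))) ∧
    Tendsto (fun n => functionalI D T (gn n) (xn n) (kn n)) atTop
      (𝓝 (functionalI D T g x k)) := by
  obtain ⟨lam, hlam, hyu⟩ := hJ1
  have hr : ∀ n, ReflectedPath D (yn n ∘ lam n) (xn n ∘ lam n) (kn n ∘ lam n)
      ((normVariationMeasure (kn n)).map (lam n).symm) := fun n =>
    ((hxkn n).reflectedPath hD).comp_orderIso (lam n)
  have hr' := hxk.reflectedPath hD
  have hyu' : ∀ N, TendstoUniformlyOn (fun n => yn n ∘ lam n) y atTop (Icc 0 N) := hyu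
  have hxu := ReflectedPath.tendstoUniformlyOn_position hD hr hr' hy hyu'
  constructor
  · exact tendsto_intervalIntegral_comp_toNNReal hD.bounded.isCompact_closure
      (fun n => (hxkn n).measurable) hxk.cadlag_x.isRegulated (fun n => (hxkn n).mem_closure)
      (fun t => tendsto_of_tendstoUniformlyOn_comp_orderIso hlam hxu) hfn hf hfn_lim
  · set F : ℕ → ℝ≥0 → ℝ := fun n s => jumpAverage (gn n) s (xn n s)
      ((normVariationMeasure (kn n)).real {s} • inwardNormal D (xn n s)) with hF
    -- In the new time scale the endpoint `T` becomes `(lam n).symm T`.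
    have hFn : ∀ n, functionalI D T (gn n) (xn n) (kn n) = ∫ s in Iic ((lam n).symm T),
        F n (lam n s) ∂((normVariationMeasure (kn n)).map (lam n).symm) := fun n => by
      rw [setIntegral_Iic_map_symm, (hxkn n).functionalI_eq hD (hgn n)]
    simp_rw [hFn]
    rw [hxk.functionalI_eq hD hg]
    refine ReflectedPath.tendsto_setIntegral_Iic_moving hD hr hr' hy hyu'
      hxk.cadlag_x.isRegulated
      (hr'.isRegulated_jumpAverage hD hxk.cadlag_x.isRegulated hxk.cadlag_k.isRegulated hg)
      (fun n => ?_) hT (hxk.measure_singleton_eq_zero hD hT hyT hy)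
      (tendsto_orderIso_symm hlam T) (fun ε hε => ?_)
    · exact (((hxkn n).reflectedPath hD).isRegulated_jumpAverage hD
        (hxkn n).cadlag_x.isRegulated (hxkn n).cadlag_k.isRegulated (hgn n)).measurable.comp
        (lam n).continuous.measurable
    · have hJ := ReflectedPath.tendstoUniformlyOn_jump hD hr hr' hy hyu' (T + 1)
      filter_upwards [eventually_abs_jumpAverage_sub_le hgn hg hgn_lim hlam
        hxk.cadlag_x.isRegulated (hr'.isRegulated_jump hD hxk.cadlag_k.isRegulated)
        (hxu (T + 1)) hJ hε] with n hn s hs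
      have := hn s hs
      rwa [map_symm_real_singleton] at this
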